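/- Let $k$ be an arbitrary field. All algebras are triples $(S,*,n)$ where $S$ is a $k$-vector space, $*$ is a bilinear multiplication on $S$ and $n:S\to k$ is a quadratic form (the norm), with polar form $n(x,y)=n(x+y)-n(x)-n(y)$; isomorphisms are linear bijections preserving multiplication and norm. The norm is isotropic if $n(x)=0$ for some $x\neq 0$, and an idempotent is an element $e$ with $e*e=e$. The split Cayley algebra $C(k)$ has basis $e_1,e_2,u_1,u_2,u_3,v_1,v_2,v_3$. Its multiplication is given by $e_i\cdot e_i=e_i$, $e_1\cdot u_i=u_i=u_i\cdot e_2$, $e_2\cdot v_i=v_i=v_i\cdot e_1$, $u_i\cdot v_i=-e_1$, $v_i\cdot u_i=-e_2$, $u_i\cdot u_{i+1}=v_{i+2}=-u_{i+1}\cdot u_i$, $v_i\cdot v_{i+1}=u_{i+2}=-v_{i+1}\cdot v_i$ (indices of the $u$'s and $v$'s modulo $3$), all other products of basis elements being $0$. Its norm vanishes on the basis elements, and the only pairs of distinct basis elements with nonzero polar form are $n(e_1,e_2)=n(u_i,v_i)=1$. Its unit is $1=e_1+e_2$; write $\bar x=n(x,1)1-x$, and let $\tau$ be the linear automorphism fixing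 $e_1,e_2$ and mapping $u_i\mapsto u_{i+1}$, $v_i\mapsto v_{i+1}$ (indices modulo $3$). The pseudo-octonion algebra $P_8(k)$ is the vector space $C(k)$ with the same norm and with the multiplication $x*y=\tau(\bar x)\cdot\tau^2(\bar y)$. An Okubo algebra over $k$ is a form of $P_8(k)$, that is, an algebra $(S,*,n)$ such that $L\otimes_k S\cong P_8(L)$ (as algebras with norm over $L$) for some field extension $L/k$. For nonzero $\alpha,\beta\in k$, let $\mathcal O_{\alpha,\beta}$ be the algebra with basis $\{x_{i,j}:-1\le i,j\le 1,\ (i,j)\ne(0,0)\}$ and the following multiplication table (row times column): $$\begin{array}{c|cccccccc} & x_{1,0}&x_{-1,0}&x_{0,1}&x_{0,-1}&x_{1,1}&x_{-1,-1}&x_{-1,1}&x_{1,-1}\\ \hline x_{1,0}&-\alpha x_{-1,0}&0&0&x_{1,-1}&0&x_{0,-1}&0&\alpha x_{-1,-1}\\ x_{-1,0}&0&-\alpha^{-1}x_{1,0}&x_{-1,1}&0&x_{0,1}&0&\alpha^{-1}x_{1,1}&0\\ x_{0,1}&x_{1,1}&0&-\beta x_{0,-1}&0&\beta x_{1,-1}&0&0&x_{1,0}\\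 x_{0,-1}&0&x_{-1,-1}&0&-\beta^{-1}x_{0,1}&0&\beta^{-1}x_{-1,1}&x_{-1,0}&0\\ x_{1,1}&\alpha x_{-1,1}&0&0&x_{1,0}&-\alpha\beta x_{-1,-1}&0&\beta x_{0,-1}&0\\ x_{-1,-1}&0&\alpha^{-1}x_{1,-1}&x_{-1,0}&0&0&-(\alpha\beta)^{-1}x_{1,1}&0&\beta^{-1}x_{0,1}\\ x_{-1,1}&x_{0,1}&0&\beta x_{-1,-1}&0&0&\alpha^{-1}x_{1,0}&-\alpha^{-1}\beta x_{1,-1}&0\\ x_{1,-1}&0&x_{0,-1}&0&\beta^{-1}x_{1,1}&\alpha x_{-1,0}&0&0&-\alpha\beta^{-1}x_{-1,1} \end{array}$$ Its norm is the quadratic form $n$ with $(x*y)*x=n(x)y$ for all $x,y$: it vanishes on the basis elements, and $n(x_{i,j},x_{-i,-j})=1$ are the only nonzero values of the polar form on pairs of distinct basis elements. **Theorem.** Let $(S,*,n)$ be an algebra with a quadratic form over $k$. Then $(S,*,n)$ is an Okubo algebra whose norm is isotropic and which contains a nonzero idempotent if and only if $(S,*,n)$ is isomorphic to $\mathcal O_{1,\beta}$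 for some nonzero $\beta\in k$. -/

import Mathlib

open scoped TensorProduct

universe u v w

noncomputable section

/-- A triple `(S, *, n)`: a vector space `S` over `k` with a bilinear multiplication `mul`
(no unit, no associativity) and a quadratic form `norm`. -/
structure NormAlgebra (k : Type u) [Field k] (S : Type v) [AddCommGroup S] [Module k S] where
  mul : S →ₗ[k] S →ₗ[k] S
  norm : QuadraticForm k S

namespace NormAlgebra

/-- Isomorphism of triples `(S, *, n)`: a linear bijection that preserves products and norms. -/
def IsIsomorphic {k : Type u} [Field k] {S : Type v} [AddCommGroup S] [Module k S]
    {T : Type w} [AddCommGroup T] [Module k T]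
    (A : NormAlgebra k S) (B : NormAlgebra k T) : Prop :=
  ∃ φ : S ≃ₗ[k] T,
    (∀ x y : S, φ (A.mul x y) = B.mul (φ x) (φ y)) ∧ ∀ x : S, B.norm (φ x) = A.norm x

/-- The norm is isotropic: some nonzero element has norm zero. -/
def HasIsotropicNorm {k : Type u} [Field k] {S : Type v} [AddCommGroup S] [Module k S]
    (A : NormAlgebra k S) : Prop :=
  ∃ x : S, x ≠ 0 ∧ A.norm x = 0

/-- There is a nonzero idempotent. -/
def HasNonzeroIdempotent {k : Type u} [Field k] {S : Type v} [AddCommGroup S] [Module k S]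
    (A : NormAlgebra k S) : Prop :=
  ∃ e : S, e ≠ 0 ∧ A.mul e e = e

end NormAlgebra

/-- The bilinear multiplication on `k⁸` for which the product of the `i`-th and the `j`-th
standard basis vectors is `T i j`. -/
def tableMul {k : Type u} [Field k] (T : Fin 8 → Fin 8 → Fin 8 → k) :
    (Fin 8 → k) →ₗ[k] (Fin 8 → k) →ₗ[k] (Fin 8 → k) :=
  LinearMap.mk₂ k (fun x y => ∑ i, ∑ j, (x i * y j) • T i j)
    (fun x x' y => by simp [add_mul, add_smul, Finset.sum_add_distrib])
    (fun c x y => by simp [Finset.smul_sum, smul_smul, mul_assoc])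
    (fun x y y' => by simp [mul_add, add_smul, Finset.sum_add_distrib])
    (fun c x y => by simp [Finset.smul_sum, smul_smul, mul_left_comm])

/-- The quadratic form `x₀x₁ + x₂x₅ + x₃x₆ + x₄x₇` of the split Cayley algebra: in the basis
`e₁, e₂, u₁, u₂, u₃, v₁, v₂, v₃`, all basis vectors have norm zero, and the polar form
is `1` on the pairs `(e₁, e₂)` and `(uᵢ, vᵢ)` and `0` on all other pairs. -/
def cayleyNorm (k : Type u) [Field k] : QuadraticForm k (Fin 8 → k) :=
  QuadraticMap.linMulLin (LinearMap.proj 0) (LinearMap.proj 1) +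
  QuadraticMap.linMulLin (LinearMap.proj 2) (LinearMap.proj 5) +
  QuadraticMap.linMulLin (LinearMap.proj 3) (LinearMap.proj 6) +
  QuadraticMap.linMulLin (LinearMap.proj 4) (LinearMap.proj 7)

/-- The multiplication table of the split Cayley algebra in its canonical basis. -/
def cayleyTable (k : Type u) [Field k] : Fin 8 → Fin 8 → Fin 8 → k :=
  let e₁ : Fin 8 → k := Pi.single 0 1
  let e₂ : Fin 8 → k := Pi.single 1 1
  let u₁ : Fin 8 → k := Pi.single 2 1
  let u₂ : Fin 8 → k := Pi.single 3 1
  let u₃ : Fin 8 → k := Pi.single 4 1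
  let v₁ : Fin 8 → k := Pi.single 5 1
  let v₂ : Fin 8 → k := Pi.single 6 1
  let v₃ : Fin 8 → k := Pi.single 7 1
  --         e₁   e₂   u₁   u₂   u₃   v₁   v₂   v₃
  ![ ![      e₁,   0,  u₁,  u₂,  u₃,   0,   0,   0],
     ![       0,  e₂,   0,   0,   0,  v₁,  v₂,  v₃],
     ![       0,  u₁,   0,  v₃, -v₂, -e₁,   0,   0],
     ![       0,  u₂, -v₃,   0,  v₁,   0, -e₁,   0],
     ![       0,  u₃,  v₂, -v₁,   0,   0,   0, -e₁],
     ![      v₁,   0, -e₂,   0,   0,   0,  u₃, -u₂],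
     ![      v₂,   0,   0, -e₂,   0, -u₃,   0,  u₁],
     ![      v₃,   0,   0,   0, -e₂,  u₂, -u₁,   0] ]

/-- The split Cayley algebra `C(k)`. -/
def splitCayley (k : Type u) [Field k] : NormAlgebra k (Fin 8 → k) where
  mul := tableMul (cayleyTable k)
  norm := cayleyNorm k

/-- The unit `e₁ + e₂` of the split Cayley algebra. -/
def cayleyOne (k : Type u) [Field k] : Fin 8 → k :=
  Pi.single 0 1 + Pi.single 1 1

/-- The standard conjugation `x ↦ n(x, 1) 1 - x` of the split Cayley algebra, where
`n(x, y) = n(x + y) - n(x) - n(y)` is the polar form. -/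
def cayleyConj (k : Type u) [Field k] : (Fin 8 → k) →ₗ[k] (Fin 8 → k) :=
  ((splitCayley k).norm.polarBilin.flip (cayleyOne k)).smulRight (cayleyOne k) - LinearMap.id

/-- The order three automorphism `τ` of the split Cayley algebra that fixes `e₁, e₂` and maps
`uᵢ ↦ uᵢ₊₁`, `vᵢ ↦ vᵢ₊₁` (indices modulo 3). -/
def cayleyTau (k : Type u) [Field k] : (Fin 8 → k) →ₗ[k] (Fin 8 → k) :=
  (Pi.basisFun k (Fin 8)).constr k
    ![Pi.single 0 1, Pi.single 1 1,
      Pi.single 3 1, Pi.single 4 1, Pi.single 2 1,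
      Pi.single 6 1, Pi.single 7 1, Pi.single 5 1]

/-- The pseudo-octonion algebra `P₈(k)`: the space `C(k)` with the norm of `C(k)` and the
multiplication `x * y = τ(x̄) · τ²(ȳ)`. -/
def pseudoOctonion (k : Type u) [Field k] : NormAlgebra k (Fin 8 → k) where
  mul := (splitCayley k).mul.compl₁₂ (cayleyTau k ∘ₗ cayleyConj k)
    (cayleyTau k ∘ₗ cayleyTau k ∘ₗ cayleyConj k)
  norm := (splitCayley k).norm

/-- An Okubo algebra is a form of the pseudo-octonion algebra: for some field extension `L` of
`k`, there is an isomorphism of `L ⊗ S` onto `P₈(L)` for the multiplications and the norms.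
The products and the norms of `L ⊗ S` are determined by those of the elements `1 ⊗ x`. -/
def NormAlgebra.IsOkubo {k : Type u} [Field k] {S : Type v} [AddCommGroup S] [Module k S]
    (A : NormAlgebra k S) : Prop :=
  ∃ (L : Type u) (_ : Field L) (_ : Algebra k L) (φ : (L ⊗[k] S) ≃ₗ[L] (Fin 8 → L)),
    (∀ x y : S, φ (1 ⊗ₜ[k] A.mul x y) =
      (pseudoOctonion L).mul (φ (1 ⊗ₜ[k] x)) (φ (1 ⊗ₜ[k] y))) ∧
    ∀ x : S, (pseudoOctonion L).norm (φ (1 ⊗ₜ[k] x)) = algebraMap k L (A.norm x)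

/-- The multiplication table of `O_{α,β}` in its basis
`x₁₀, x₋₁₀, x₀₁, x₀₋₁, x₁₁, x₋₁₋₁, x₋₁₁, x₁₋₁`, here written
`p0, m0, zp, zm, pp, mm, mp, pm`. -/
def okuboTable {k : Type u} [Field k] (α β : k) : Fin 8 → Fin 8 → Fin 8 → k :=
  let p0 : Fin 8 → k := Pi.single 0 1
  let m0 : Fin 8 → k := Pi.single 1 1
  let zp : Fin 8 → k := Pi.single 2 1
  let zm : Fin 8 → k := Pi.single 3 1
  let pp : Fin 8 → k := Pi.single 4 1
  let mm : Fin 8 → k := Pi.single 5 1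
  let mp : Fin 8 → k := Pi.single 6 1
  let pm : Fin 8 → k := Pi.single 7 1
  ![ ![-α • m0, 0, 0, pm, 0, zm, 0, α • mm],
     ![0, -α⁻¹ • p0, mp, 0, zp, 0, α⁻¹ • pp, 0],
     ![pp, 0, -β • zm, 0, β • pm, 0, 0, p0],
     ![0, mm, 0, -β⁻¹ • zp, 0, β⁻¹ • mp, m0, 0],
     ![α • mp, 0, 0, p0, -(α * β) • mm, 0, β • zm, 0],
     ![0, α⁻¹ • pm, m0, 0, 0, -(α * β)⁻¹ • pp, 0, β⁻¹ • zp],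
     ![zp, 0, β • mm, 0, 0, α⁻¹ • p0, -(α⁻¹ * β) • pm, 0],
     ![0, zm, 0, β⁻¹ • pp, α • m0, 0, 0, -(α * β⁻¹) • mp] ]

/-- The algebra `O_{α,β}` (for nonzero `α`, `β`). Its norm is the quadratic form `n` determined
by `(x * y) * x = n(x) y`: the basis vectors have norm zero, and the polar form is `1` on the
pairs `(x_{i,j}, x_{-i,-j})` and `0` on all other pairs of basis vectors. -/
def okuboO {k : Type u} [Field k] (α β : k) : NormAlgebra k (Fin 8 → k) where
  mul := tableMul (okuboTable α β)
  norm :=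
    QuadraticMap.linMulLin (LinearMap.proj 0) (LinearMap.proj 1) +
    QuadraticMap.linMulLin (LinearMap.proj 2) (LinearMap.proj 3) +
    QuadraticMap.linMulLin (LinearMap.proj 4) (LinearMap.proj 5) +
    QuadraticMap.linMulLin (LinearMap.proj 6) (LinearMap.proj 7)

end

/-!
Write `g(x) = n(x, x * x)` for the cubic form of a symmetric composition algebra `S`, that is, an
algebra with a nondegenerate multiplicative norm and `(x * y) * x = n(x) y = x * (y * x)`.

*Recognition.* Suppose that `dim S = 8` and that `a, b` satisfy `n(a) = n(b) = 0`, `a * b = 0`,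
`n(a, b) = 0`, `g(a) = -α ≠ 0` and `g(b) = -β ≠ 0`. Then `S ≅ O_{α,β}`, with `a = x_{1,0}` and
`b = x_{0,1}`: see `GeneratingPair.isIsomorphic_okuboO`. The pairs `(b, a')` and `(a, b * a)`, where
`a' = -α⁻¹ a * a`, are again of this kind for other scalars, and the two moves generate `SL₂(𝔽₃)`,
which acts transitively on the ordered bases of determinant one of the index group `𝔽₃²`. So the
whole table follows from a few products computed for one pair. The pair `a = -e₁`, `b = -γ u₁` of
`P₈(L)` gives `P₈(L) ≅ O_{1,γ³}`. With `L` algebraically closed and `γ³ = β` this shows that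
`O_{1,β}` is an Okubo algebra; `-(x_{1,0} + x_{-1,0})` is an idempotent.

*Descent.* An Okubo algebra inherits from `P₈(L)` that it is a symmetric composition algebra of
dimension eight, that the maps `ad c : x ↦ c * x - x * c` are derivations, and that only `0`
commutes with everything. These properties are all that is used of it from then on.

*The element `a`.* Let `e` be a nonzero idempotent, so `n(e) = 1`, and let `D = ad e`; then
`D³ = -3D`. If `3 ≠ 0` in `k`, then `S = ker D ⊕ ker (D² + 3)`, and `g = 0` on `ker (D² + 3)`
because `D` is a derivation. Hence `g(e + y) = -1` and `n(e + y) = 0` for each `y` in `ker (D² + 3)`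
of norm `-1`; such a `y` is produced from an isotropic vector unless `ker D` is isotropic, in which
case `ker D` contains a suitable `a` (`exists_cubicForm_eq_neg_one`). If `3 = 0`, then `g` is
additive and vanishes on the image of `D`, and `g(x) = n(e, x)³` on `X = ker D + im D`. Since `S`
has totally isotropic subspaces of dimension four and `X^⊥ ⊊ X`, a dimension count gives an
isotropic vector of `X` outside `X^⊥`, hence one that is not orthogonal to `e`
(`exists_cubicForm_eq_neg_one_of_three`).

*The element `b`.* Given `a` with `n(a) = 0`, `g(a) = -1` and `a' = -a * a`, the orthogonal
complement of `a, a'` is `U ⊕ W` with `U = {x : a * x = 0 = x * a'}` and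
`W = {x : a' * x = 0 = x * a}`; both have dimension three. On `U` there is a volume form, invariant
under `T : x ↦ x * a`, such that `T³ = 1` and `g(b) = vol(b, Tb, T²b)`. If `3 ≠ 0`, the derivation
property says that `T` and `T²` have trace zero on `U`. Then `T` has the three cube roots of unity
as its eigenvalues, so some orbit `b, Tb, T²b` has nonzero volume (`exists_volume_orbit_ne_zero`,
formulated without eigenvalues). If `3 = 0` and `g = 0` on `U`, then `g = 0` on `W` too and
`g(v) = -n(a + a', v)³`. Were this to happen for every choice of `a`, then comparing `a` with
`a + x` for `x ∈ U` would give `x * a = x` on `U`, and `a + a'` would commute with everything, which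
is impossible (`exists_cubicForm_ne_zero_of_three`).
-/

namespace NormAlgebra

variable {k : Type u} [Field k] {S : Type v} [AddCommGroup S] [Module k S] {A : NormAlgebra k S}

local notation:70 x:70 " ⋆ " y:71 => NormAlgebra.mul A x y
local notation "⟪" x ", " y "⟫" => QuadraticMap.polar (NormAlgebra.norm A) x y

/-! ### Symmetric composition algebras -/

/-- Symmetric composition algebras: the norm is multiplicative and nondegenerate (its polar form
has trivial radical), and `(x * y) * x = n(x) y = x * (y * x)`. The associativity of the polar form,
a consequence of the other axioms, is included for convenience. -/
structure IsSymmComposition {k : Type u} [Field k] {S : Type v} [AddCommGroup S] [Module k S]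
    (A : NormAlgebra k S) : Prop where
  mul_mul_self : ∀ x y, A.mul (A.mul x y) x = A.norm x • y
  self_mul_mul : ∀ x y, A.mul x (A.mul y x) = A.norm x • y
  polar_mul : ∀ x y z,
    QuadraticMap.polar A.norm (A.mul x y) z = QuadraticMap.polar A.norm x (A.mul y z)
  norm_mul : ∀ x y, A.norm (A.mul x y) = A.norm x * A.norm y
  nondegenerate : ∀ x, (∀ y, QuadraticMap.polar A.norm x y = 0) → x = 0

variable (A) in
/-- The cubic form `g(x) = n(x, x * x)`. -/
def cubicForm (x : S) : k := ⟪x, x ⋆ x⟫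

theorem polar_self_eq (x : S) : ⟪x, x⟫ = 2 * A.norm x := by
  simp

theorem norm_add (x y : S) : A.norm (x + y) = A.norm x + A.norm y + ⟪x, y⟫ :=
  QuadraticMap.map_add _ _ _

namespace IsSymmComposition

/-- Linearization of `(x * y) * x = n(x) y`. -/
theorem mul_mul_add (H : A.IsSymmComposition) (x y z : S) :
    (x ⋆ y) ⋆ z + (z ⋆ y) ⋆ x = ⟪x, z⟫ • y := by
  have h := H.mul_mul_self (x + z) y
  simp only [map_add, LinearMap.add_apply, H.mul_mul_self, norm_add, add_smul] at h
  linear_combination (norm := module) h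

/-- Linearization of `x * (y * x) = n(x) y`. -/
theorem mul_add_mul (H : A.IsSymmComposition) (x y z : S) :
    x ⋆ (y ⋆ z) + z ⋆ (y ⋆ x) = ⟪x, z⟫ • y := by
  have h := H.self_mul_mul (x + z) y
  simp only [map_add, LinearMap.add_apply, H.self_mul_mul, norm_add, add_smul] at h
  linear_combination (norm := module) h

theorem polar_rotate (H : A.IsSymmComposition) (x y z : S) : ⟪x ⋆ y, z⟫ = ⟪y ⋆ z, x⟫ := by
  rw [H.polar_mul, QuadraticMap.polar_comm]

theorem sq_mul_sq (H : A.IsSymmComposition) (x : S) :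
    (x ⋆ x) ⋆ (x ⋆ x) = A.cubicForm x • x - A.norm x • (x ⋆ x) := by
  have := H.mul_mul_add x x (x ⋆ x)
  rw [H.mul_mul_self] at this
  simp only [map_smul, LinearMap.smul_apply] at this
  rw [cubicForm]
  linear_combination (norm := module) this

end IsSymmComposition

/-! ### Pairs of elements that generate the algebra -/

variable (A) in
/-- The relations between `a = x_{1,0}`, `a' = x_{-1,0}`, `b = x_{0,1}` and `b' = x_{0,-1}` in an
algebra `O_{α,β}`. They are redundant: `IsSymmComposition.generatingPair` derives them from a few
conditions on `a` and `b`. The list is closed under the symmetry `rotate`. -/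
structure GeneratingPair (α β : k) (a a' b b' : S) : Prop where
  α_ne : α ≠ 0
  β_ne : β ≠ 0
  norm_a : A.norm a = 0
  norm_a' : A.norm a' = 0
  norm_b : A.norm b = 0
  norm_b' : A.norm b' = 0
  a_mul_a : a ⋆ a = -(α • a')
  a'_mul_a' : a' ⋆ a' = -(α⁻¹ • a)
  b_mul_b : b ⋆ b = -(β • b')
  b'_mul_b' : b' ⋆ b' = -(β⁻¹ • b)
  a_mul_a' : a ⋆ a' = 0
  a'_mul_a : a' ⋆ a = 0
  b_mul_b' : b ⋆ b' = 0
  b'_mul_b : b' ⋆ b = 0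
  polar_a_a' : ⟪a, a'⟫ = 1
  polar_b_b' : ⟪b, b'⟫ = 1
  a_mul_b : a ⋆ b = 0
  b_mul_a' : b ⋆ a' = 0
  a'_mul_b' : a' ⋆ b' = 0
  b'_mul_a : b' ⋆ a = 0
  polar_a_b : ⟪a, b⟫ = 0
  polar_a_b' : ⟪a, b'⟫ = 0
  polar_a'_b : ⟪a', b⟫ = 0
  polar_a'_b' : ⟪a', b'⟫ = 0

namespace GeneratingPair
variable {α β : k} {a a' b b' : S}

/-- The change of basis `(x_{1,0}, x_{0,1}) ↦ (x_{0,1}, x_{-1,0})`. -/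
theorem rotate (h : A.GeneratingPair α β a a' b b') : A.GeneratingPair β α⁻¹ b b' a' a where
  α_ne := h.β_ne
  β_ne := inv_ne_zero h.α_ne
  norm_a := h.norm_b
  norm_a' := h.norm_b'
  norm_b := h.norm_a'
  norm_b' := h.norm_a
  a_mul_a := h.b_mul_b
  a'_mul_a' := h.b'_mul_b'
  b_mul_b := h.a'_mul_a'
  b'_mul_b' := by rw [inv_inv]; exact h.a_mul_a
  a_mul_a' := h.b_mul_b'
  a'_mul_a := h.b'_mul_b
  b_mul_b' := h.a'_mul_a
  b'_mul_b := h.a_mul_a'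
  polar_a_a' := h.polar_b_b'
  polar_b_b' := by rw [QuadraticMap.polar_comm]; exact h.polar_a_a'
  a_mul_b := h.b_mul_a'
  b_mul_a' := h.a'_mul_b'
  a'_mul_b' := h.b'_mul_a
  b'_mul_a := h.a_mul_b
  polar_a_b := by rw [QuadraticMap.polar_comm]; exact h.polar_a'_b
  polar_a_b' := by rw [QuadraticMap.polar_comm]; exact h.polar_a_b
  polar_a'_b := by rw [QuadraticMap.polar_comm]; exact h.polar_a'_b'
  polar_a'_b' := by rw [QuadraticMap.polar_comm]; exact h.polar_a_b'

theorem mul_a (H : A.IsSymmComposition) (h : A.GeneratingPair α β a a' b b') :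
    (b ⋆ a) ⋆ a = α • (a' ⋆ b) := by
  have := H.mul_mul_add b a a
  rw [QuadraticMap.polar_comm, h.polar_a_b, h.a_mul_a] at this
  simp only [map_neg, map_smul, LinearMap.neg_apply, LinearMap.smul_apply] at this
  linear_combination (norm := module) this

theorem a'_mul (H : A.IsSymmComposition) (h : A.GeneratingPair α β a a' b b') :
    a' ⋆ (b ⋆ a) = b := by
  have := H.mul_add_mul a b a'
  rw [h.polar_a_a', h.b_mul_a'] at this
  simpa using this

theorem mul'_a' (H : A.IsSymmComposition) (h : A.GeneratingPair α β a a' b b') :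
    (b' ⋆ a') ⋆ a' = α⁻¹ • (a ⋆ b') := by
  have := H.mul_mul_add b' a' a'
  rw [QuadraticMap.polar_comm, h.polar_a'_b', h.a'_mul_a'] at this
  simp only [map_neg, map_smul, LinearMap.neg_apply, LinearMap.smul_apply] at this
  linear_combination (norm := module) this

theorem a_mul' (H : A.IsSymmComposition) (h : A.GeneratingPair α β a a' b b') :
    a ⋆ (b' ⋆ a') = b' := by
  have := H.mul_add_mul a b' a'
  rw [h.polar_a_a', h.b'_mul_a] at this
  simpa using this

theorem mul_mul_mul (H : A.IsSymmComposition) (h : A.GeneratingPair α β a a' b b') :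
    (b ⋆ a) ⋆ (b ⋆ a) = -((α * β) • (b' ⋆ a')) := by
  have h1 := H.mul_mul_add b a (b ⋆ a)
  have h2 : ⟪b, b ⋆ a⟫ = 0 := by
    rw [← H.polar_mul, h.b_mul_b, QuadraticMap.polar_neg_left, QuadraticMap.polar_smul_left,
      QuadraticMap.polar_comm, h.polar_a_b']
    simp
  rw [h2, h.mul_a H] at h1
  have h3 := H.mul_mul_add a' b b
  rw [h.polar_a'_b, h.b_mul_b] at h3
  simp only [map_neg, map_smul, LinearMap.neg_apply, LinearMap.smul_apply] at h1 h3
  linear_combination (norm := module) h1 - α • h3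

theorem mul'_mul_mul' (H : A.IsSymmComposition) (h : A.GeneratingPair α β a a' b b') :
    (b' ⋆ a') ⋆ (b' ⋆ a') = -((α * β)⁻¹ • (b ⋆ a)) := by
  have h1 := H.mul_mul_add b' a' (b' ⋆ a')
  have h2 : ⟪b', b' ⋆ a'⟫ = 0 := by
    rw [← H.polar_mul, h.b'_mul_b', QuadraticMap.polar_neg_left, QuadraticMap.polar_smul_left,
      QuadraticMap.polar_comm, h.polar_a'_b]
    simp
  rw [h2, h.mul'_a' H] at h1
  have h3 := H.mul_mul_add a b' b'
  rw [h.polar_a_b', h.b'_mul_b'] at h3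
  simp only [map_neg, map_smul, LinearMap.neg_apply, LinearMap.smul_apply] at h1 h3
  rw [mul_inv]
  linear_combination (norm := module) h1 - α⁻¹ • h3

/-- The change of basis `(x_{1,0}, x_{0,1}) ↦ (x_{1,0}, x_{1,1})`. Together with `rotate` it
generates all changes of basis of determinant one. -/
theorem shear (H : A.IsSymmComposition) (h : A.GeneratingPair α β a a' b b') :
    A.GeneratingPair α (α * β) a a' (b ⋆ a) (b' ⋆ a') where
  α_ne := h.α_ne
  β_ne := mul_ne_zero h.α_ne h.β_ne
  norm_a := h.norm_a
  norm_a' := h.norm_a'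
  norm_b := by rw [H.norm_mul, h.norm_b, zero_mul]
  norm_b' := by rw [H.norm_mul, h.norm_b', zero_mul]
  a_mul_a := h.a_mul_a
  a'_mul_a' := h.a'_mul_a'
  b_mul_b := h.mul_mul_mul H
  b'_mul_b' := h.mul'_mul_mul' H
  a_mul_a' := h.a_mul_a'
  a'_mul_a := h.a'_mul_a
  b_mul_b' := by
    -- `c * c'` is a multiple of `c * (c * c) = n(c) c`, which vanishes
    have h1 := H.self_mul_mul (b ⋆ a) (b ⋆ a)
    rw [h.mul_mul_mul H, H.norm_mul, h.norm_b] at h1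
    simpa [h.α_ne, h.β_ne] using h1
  b'_mul_b := by
    have h1 := H.mul_mul_self (b ⋆ a) (b ⋆ a)
    rw [h.mul_mul_mul H, H.norm_mul, h.norm_b] at h1
    simpa [h.α_ne, h.β_ne] using h1
  polar_a_a' := h.polar_a_a'
  polar_b_b' := by rw [H.polar_mul, h.a_mul' H, h.polar_b_b']
  a_mul_b := by rw [H.self_mul_mul, h.norm_a, zero_smul]
  b_mul_a' := by
    have := H.mul_mul_add b a a'
    rwa [h.a'_mul_a, QuadraticMap.polar_comm, h.polar_a'_b, map_zero, LinearMap.zero_apply,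
      add_zero, zero_smul] at this
  a'_mul_b' := by rw [H.self_mul_mul, h.norm_a', zero_smul]
  b'_mul_a := by
    have := H.mul_mul_add b' a' a
    rwa [h.a_mul_a', QuadraticMap.polar_comm, h.polar_a_b', map_zero, LinearMap.zero_apply,
      add_zero, zero_smul] at this
  polar_a_b := by rw [← H.polar_mul, h.a_mul_b]; simp
  polar_a_b' := by
    rw [QuadraticMap.polar_comm, H.polar_mul, h.a'_mul_a]; simp
  polar_a'_b := by
    rw [QuadraticMap.polar_comm, H.polar_mul, h.a_mul_a']; simp
  polar_a'_b' := by rw [← H.polar_mul, h.a'_mul_b']; simp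

end GeneratingPair

/-- Two isotropic vectors `a, b` with `a * b = 0`, `n(a, b) = 0` and `g(a), g(b) ≠ 0` generate a
copy of `O_{α,β}`: the remaining relations follow. -/
theorem IsSymmComposition.generatingPair (H : A.IsSymmComposition) {α β : k} {a b : S}
    (hα : α ≠ 0) (hβ : β ≠ 0) (ha : A.norm a = 0) (hb : A.norm b = 0)
    (hga : A.cubicForm a = -α) (hgb : A.cubicForm b = -β) (hab : a ⋆ b = 0) (pab : ⟪a, b⟫ = 0) :
    A.GeneratingPair α β a (-(α⁻¹ • (a ⋆ a))) b (-(β⁻¹ • (b ⋆ b))) := by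
  have hsa := H.sq_mul_sq a
  have hsb := H.sq_mul_sq b
  have hga' : ⟪a, a ⋆ a⟫ = -α := hga
  have hgb' : ⟪b, b ⋆ b⟫ = -β := hgb
  have hba' : b ⋆ (a ⋆ a) = 0 := by
    have := H.mul_add_mul b a a
    rwa [hab, map_zero, add_zero, QuadraticMap.polar_comm, pab, zero_smul] at this
  have hb'a : (b ⋆ b) ⋆ a = 0 := by
    have := H.mul_mul_add b b a
    rwa [hab, map_zero, LinearMap.zero_apply, add_zero, QuadraticMap.polar_comm, pab,
      zero_smul] at this
  have ha'b' : (a ⋆ a) ⋆ (b ⋆ b) = 0 := by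
    have := H.mul_mul_add a a (b ⋆ b)
    rwa [hb'a, map_zero, LinearMap.zero_apply, add_zero, ← H.polar_mul, hab,
      QuadraticMap.polar_zero_left, zero_smul] at this
  have e1 : ⟪a, b ⋆ b⟫ = 0 := by rw [← H.polar_mul, hab]; simp
  have e2 : ⟪a ⋆ a, b⟫ = 0 := by rw [H.polar_mul, hab]; simp
  have e3 : ⟪a ⋆ a, b ⋆ b⟫ = 0 := by rw [QuadraticMap.polar_comm, H.polar_mul, hba']; simp
  constructor <;>
    simp [QuadraticMap.map_neg, QuadraticMap.map_smul, QuadraticMap.polar_neg_right,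
      QuadraticMap.polar_neg_left, QuadraticMap.polar_smul_left, QuadraticMap.polar_smul_right,
      H.norm_mul, smul_smul, *, H.mul_mul_self, H.self_mul_mul]

/-! ### The multiplication table of a generating pair -/

variable (A) in
/-- The candidates for the basis `x₁₀, x₋₁₀, x₀₁, x₀₋₁, x₁₁, x₋₁₋₁, x₋₁₁, x₁₋₁` of `O_{α,β}`, in the
order of `okuboTable`. -/
def okuboBasis (a a' b b' : S) : Fin 8 → S :=
  ![a, a', b, b', b ⋆ a, b' ⋆ a', a' ⋆ b, a ⋆ b']

namespace GeneratingPair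
variable {α β : k} {a a' b b' : S}

theorem okuboBasis_mul (H : A.IsSymmComposition) (h : A.GeneratingPair α β a a' b b')
    (i j : Fin 8) :
    okuboBasis A a a' b b' i ⋆ okuboBasis A a a' b b' j =
      ∑ l, okuboTable α β i j l • okuboBasis A a a' b b' l := by
  have hα := h.α_ne
  have hβ := h.β_ne
  -- Any two of the four lines of `𝔽₃²` are spanned by one of six pairs; `h`, `h2`, `h3`, `h4`, `h6`,
  -- `h7` below are the generating pairs, up to scalars, for these choices of lines.
  obtain ⟨s1, s2, s3, s4⟩ := And.intro (h.mul_a H) (And.intro (h.a'_mul H)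
    (And.intro (h.mul'_a' H) (h.a_mul' H)))
  have h2 := h.shear H
  obtain ⟨t1, t2, t3, t4⟩ := And.intro (h2.mul_a H) (And.intro (h2.a'_mul H)
    (And.intro (h2.mul'_a' H) (h2.a_mul' H)))
  have h3 := h2.shear H
  have hr := h.rotate
  obtain ⟨r1, r2, r3, r4⟩ := And.intro (hr.mul_a H) (And.intro (hr.a'_mul H)
    (And.intro (hr.mul'_a' H) (hr.a_mul' H)))
  have h4 := hr.shear H
  have h2r := h2.rotate
  obtain ⟨q1, q2, q3, q4⟩ := And.intro (h2r.mul_a H) (And.intro (h2r.a'_mul H)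
    (And.intro (h2r.mul'_a' H) (h2r.a_mul' H)))
  have h6 := h2r.shear H
  obtain ⟨p1, p2, p3, p4⟩ := And.intro (h6.mul_a H) (And.intro (h6.a'_mul H)
    (And.intro (h6.mul'_a' H) (h6.a_mul' H)))
  have h7 := h6.shear H
  simp only [s1, s2, s3, s4, map_smul, LinearMap.smul_apply, smul_smul] at t1 t2 t3 t4 q1 q2 q3 q4
  simp only [s2, s4, q1, q3, map_smul, LinearMap.smul_apply] at p1 p2 p3 p4
  simp only [s1, s3] at h3
  simp only [s2, s4] at h6
  simp only [s2, s4, q1, q3] at h7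
  obtain ⟨y1, y2, y3, y4⟩ := And.intro h3.a_mul_b (And.intro h3.b_mul_a'
    (And.intro h3.a'_mul_b' h3.b'_mul_a))
  obtain ⟨z1, z2, z3, z4⟩ := And.intro h7.a_mul_b (And.intro h7.b_mul_a'
    (And.intro h7.a'_mul_b' h7.b'_mul_a))
  generalize hc : b ⋆ a = c at *
  generalize hc' : b' ⋆ a' = c' at *
  generalize hd : a' ⋆ b = d at *
  generalize hd' : a ⋆ b' = d' at *
  simp only [map_smul, LinearMap.smul_apply, smul_eq_zero, mul_eq_zero, inv_eq_zero, hα, hβ,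
    false_or] at y1 y2 y3 y4 z1 z2 z3 z4
  have e1 : α * β * α⁻¹ = β := by field_simp
  have e2 : (α * β)⁻¹ * α = β⁻¹ := by field_simp
  simp only [e1, e2, q2, q4] at p1 p2 p3 p4 q1 q3
  replace t1 : d ⋆ a = b := smul_right_injective S hα t1
  replace t2 : a' ⋆ d = α⁻¹ • c := (eq_inv_smul_iff₀ hα).2 t2
  replace t3 : d' ⋆ a' = b' := smul_right_injective S (inv_ne_zero hα) t3
  replace t4 : a ⋆ d' = α • c' := (inv_smul_eq_iff₀ hα).1 t4
  replace p1 : d' ⋆ c = α • a' := by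
    rw [mul_comm α β, mul_smul] at p1
    exact smul_right_injective S hβ p1
  replace p2 : c' ⋆ d' = β⁻¹ • b := (eq_inv_smul_iff₀ hβ).2 p2
  replace p3 : d ⋆ c' = α⁻¹ • a := by
    rw [mul_inv_rev, mul_smul] at p3
    exact smul_right_injective S (inv_ne_zero hβ) p3
  replace p4 : c ⋆ d = β • b' := (inv_smul_eq_iff₀ hβ).1 p4
  fin_cases i <;> fin_cases j <;>
    simp [okuboBasis, okuboTable, Pi.single_apply, *, h.a_mul_a, h.a'_mul_a',
      h.b_mul_b, h.b'_mul_b', h.a_mul_a', h.a'_mul_a, h.b_mul_b', h.b'_mul_b, h.a_mul_b,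
      h.b_mul_a', h.a'_mul_b', h.b'_mul_a, h2.b_mul_b, h2.b'_mul_b', h2.b_mul_b', h2.b'_mul_b,
      h2.a_mul_b, h2.b_mul_a', h2.a'_mul_b', h2.b'_mul_a, h4.b_mul_b, h4.b'_mul_b', h4.b_mul_b',
      h4.b'_mul_b, h4.a_mul_b, h4.b_mul_a', h4.a'_mul_b', h4.b'_mul_a, h6.a_mul_b, h6.b_mul_a',
      h6.a'_mul_b', h6.b'_mul_a, mul_comm]

theorem norm_okuboBasis_sum (H : A.IsSymmComposition) (h : A.GeneratingPair α β a a' b b')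
    (c : Fin 8 → k) :
    A.norm (∑ i, c i • okuboBasis A a a' b b' i) = (okuboO α β).norm c := by
  have hα := h.α_ne
  have hβ := h.β_ne
  have h2 := h.shear H
  have h3 := h2.shear H
  have h4 := h.rotate.shear H
  have h6 := h2.rotate.shear H
  have h7 := h6.shear H
  have e1 : α * β * α⁻¹ = β := by field_simp
  have e2 : (α * β)⁻¹ * α = β⁻¹ := by field_simp
  rw [h.mul_a H, h.mul'_a' H] at h3
  rw [h2.rotate.mul_a H, h2.rotate.mul'_a' H, h.mul_a H, h.mul'_a' H] at h7
  simp only [h.a'_mul H, h.a_mul' H] at h6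
  obtain ⟨y1, y2, y3, y4⟩ := And.intro h3.polar_a_b (And.intro h3.polar_a_b'
    (And.intro h3.polar_a'_b h3.polar_a'_b'))
  obtain ⟨z1, z2, z3, z4⟩ := And.intro h7.polar_a_b (And.intro h7.polar_a_b'
    (And.intro h7.polar_a'_b h7.polar_a'_b'))
  simp only [QuadraticMap.polar_smul_right, smul_eq_mul, mul_eq_zero, inv_eq_zero, hα, hβ,
    false_or, or_false] at y1 y2 y3 y4 z1 z2 z3 z4
  have w1 : ⟪b, b ⋆ a⟫ = 0 := by rw [QuadraticMap.polar_comm]; exact h6.polar_a_b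
  have w2 : ⟪b, b' ⋆ a'⟫ = 0 := by rw [QuadraticMap.polar_comm]; exact h6.polar_a'_b
  have w3 : ⟪b', b ⋆ a⟫ = 0 := by rw [QuadraticMap.polar_comm]; exact h6.polar_a_b'
  have w4 : ⟪b', b' ⋆ a'⟫ = 0 := by rw [QuadraticMap.polar_comm]; exact h6.polar_a'_b'
  simp [Fin.sum_univ_eight, okuboBasis, okuboO, norm_add, QuadraticMap.map_smul,
    QuadraticMap.polar_smul_left, QuadraticMap.polar_smul_right, QuadraticMap.polar_add_left,
    h.norm_a, h.norm_a', h.norm_b, h.norm_b', h2.norm_b, h2.norm_b', h4.norm_b, h4.norm_b',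
    h.polar_a_a', h.polar_b_b', h2.polar_b_b', h4.polar_b_b', h.polar_a_b, h.polar_a_b',
    h.polar_a'_b, h.polar_a'_b', h2.polar_a_b, h2.polar_a_b', h2.polar_a'_b, h2.polar_a'_b',
    h4.polar_a_b, h4.polar_a_b', h4.polar_a'_b, h4.polar_a'_b', w1, w2, w3, w4,
    y1, y2, y3, y4, z1, z2, z3, z4]
  ring

/-- A symmetric composition algebra of dimension eight with a generating pair is `O_{α,β}`. The
linear map that sends the basis of `O_{α,β}` to `okuboBasis` is injective because it preserves a
nondegenerate norm. -/
theorem isIsomorphic_okuboO (H : A.IsSymmComposition) (h : A.GeneratingPair α β a a' b b')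
    (hdim : Module.finrank k S = 8) : A.IsIsomorphic (okuboO α β) := by
  set X := okuboBasis A a a' b b' with hX
  set f : (Fin 8 → k) →ₗ[k] S := Fintype.linearCombination k X with hf
  have hfx : ∀ c, f c = ∑ i, c i • X i := fun c => Fintype.linearCombination_apply k X c
  have hnorm : ∀ c, A.norm (f c) = (okuboO α β).norm c := fun c => by
    rw [hfx]; exact h.norm_okuboBasis_sum H c
  have hmul : ∀ x y, f ((okuboO α β).mul x y) = f x ⋆ f y := fun x y => by
    have e : (okuboO α β).mul x y = ∑ i, ∑ j, (x i * y j) • okuboTable α β i j := rfl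
    have hT : ∀ i j, f (okuboTable α β i j) = X i ⋆ X j := fun i j => by
      rw [hfx]; exact (h.okuboBasis_mul H i j).symm
    simp only [e, map_sum, map_smul, hT, hfx x, hfx y, LinearMap.sum_apply, LinearMap.smul_apply,
      smul_smul, Finset.smul_sum]
    rw [Finset.sum_comm]
    simp only [mul_comm]
  have hinj : Function.Injective f := by
    rw [← LinearMap.ker_eq_bot, LinearMap.ker_eq_bot']
    intro c hc
    have key : ∀ d, (okuboO α β).norm (c + d) = (okuboO α β).norm d := fun d => by
      rw [← hnorm, ← hnorm, map_add, hc, zero_add]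
    -- comparing the norms of `c` and of `c` plus a basis vector isolates one coordinate of `c`
    have h0 := key 0
    have h1 : ∀ l, (okuboO α β).norm (c + Pi.single l 1) = 0 := fun l => by
      rw [key]; fin_cases l <;> simp [okuboO]
    ext l
    fin_cases l
    · have h1 := h1 1; simp [okuboO] at h0 h1 ⊢; linear_combination h1 - h0
    · have h1 := h1 0; simp [okuboO] at h0 h1 ⊢; linear_combination h1 - h0
    · have h1 := h1 3; simp [okuboO] at h0 h1 ⊢; linear_combination h1 - h0
    · have h1 := h1 2; simp [okuboO] at h0 h1 ⊢; linear_combination h1 - h0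
    · have h1 := h1 5; simp [okuboO] at h0 h1 ⊢; linear_combination h1 - h0
    · have h1 := h1 4; simp [okuboO] at h0 h1 ⊢; linear_combination h1 - h0
    · have h1 := h1 7; simp [okuboO] at h0 h1 ⊢; linear_combination h1 - h0
    · have h1 := h1 6; simp [okuboO] at h0 h1 ⊢; linear_combination h1 - h0
  have : FiniteDimensional k S := Module.finite_of_finrank_pos (by omega)
  let e := LinearMap.linearEquivOfInjective f hinj (by simp [hdim])
  have he : ∀ x, e x = f x := fun x => rfl
  refine ⟨e.symm, fun x y => ?_, fun x => ?_⟩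
  · rw [LinearEquiv.symm_apply_eq, he, hmul, ← he, ← he, e.apply_symm_apply, e.apply_symm_apply]
  · rw [← hnorm, ← he, e.apply_symm_apply]

end GeneratingPair

/-! ### The pseudo-octonion algebra in coordinates -/

theorem splitCayley_mul {L : Type u} [Field L] (x y : Fin 8 → L) :
    (splitCayley L).mul x y =
      ![x 0 * y 0 - x 2 * y 5 - x 3 * y 6 - x 4 * y 7,
        x 1 * y 1 - x 5 * y 2 - x 6 * y 3 - x 7 * y 4,
        x 0 * y 2 + x 2 * y 1 + x 6 * y 7 - x 7 * y 6,
        x 0 * y 3 + x 3 * y 1 - x 5 * y 7 + x 7 * y 5,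
        x 0 * y 4 + x 4 * y 1 + x 5 * y 6 - x 6 * y 5,
        x 1 * y 5 + x 5 * y 0 + x 3 * y 4 - x 4 * y 3,
        x 1 * y 6 + x 6 * y 0 - x 2 * y 4 + x 4 * y 2,
        x 1 * y 7 + x 7 * y 0 + x 2 * y 3 - x 3 * y 2] := by
  ext l
  simp only [splitCayley, tableMul, LinearMap.mk₂_apply, cayleyTable, Fin.sum_univ_eight]
  fin_cases l <;> simp <;> ring

theorem cayleyConj_apply {L : Type u} [Field L] (x : Fin 8 → L) :
    cayleyConj L x = ![x 1, x 0, -x 2, -x 3, -x 4, -x 5, -x 6, -x 7] := by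
  ext l
  fin_cases l <;>
    simp [cayleyConj, splitCayley, cayleyNorm, cayleyOne, QuadraticMap.polar] <;> ring

theorem cayleyTau_apply {L : Type u} [Field L] (x : Fin 8 → L) :
    cayleyTau L x = ![x 0, x 1, x 4, x 2, x 3, x 7, x 5, x 6] := by
  ext l
  simp only [cayleyTau, Module.Basis.constr_apply_fintype, Fin.sum_univ_eight]
  fin_cases l <;> simp

theorem pseudoOctonion_mul {L : Type u} [Field L] (x y : Fin 8 → L) :
    (pseudoOctonion L).mul x y =
      ![x 1 * y 1 - x 4 * y 6 - x 2 * y 7 - x 3 * y 5,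
        x 0 * y 0 - x 7 * y 3 - x 5 * y 4 - x 6 * y 2,
        -(x 1 * y 3) - x 4 * y 0 + x 5 * y 5 - x 6 * y 7,
        -(x 1 * y 4) - x 2 * y 0 - x 7 * y 5 + x 6 * y 6,
        -(x 1 * y 2) - x 3 * y 0 + x 7 * y 7 - x 5 * y 6,
        -(x 0 * y 6) - x 7 * y 1 + x 2 * y 2 - x 3 * y 4,
        -(x 0 * y 7) - x 5 * y 1 - x 4 * y 2 + x 3 * y 3,
        -(x 0 * y 5) - x 6 * y 1 + x 4 * y 4 - x 2 * y 3] := by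
  have h : (pseudoOctonion L).mul x y =
      (splitCayley L).mul (cayleyTau L (cayleyConj L x))
        (cayleyTau L (cayleyTau L (cayleyConj L y))) := rfl
  rw [h, splitCayley_mul, cayleyConj_apply, cayleyConj_apply, cayleyTau_apply, cayleyTau_apply,
    cayleyTau_apply]
  ext l
  fin_cases l <;> simp <;> ring

theorem pseudoOctonion_norm {L : Type u} [Field L] (x : Fin 8 → L) :
    (pseudoOctonion L).norm x = x 0 * x 1 + x 2 * x 5 + x 3 * x 6 + x 4 * x 7 := by
  simp [pseudoOctonion, splitCayley, cayleyNorm]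

theorem pseudoOctonion_polar {L : Type u} [Field L] (x y : Fin 8 → L) :
    QuadraticMap.polar (pseudoOctonion L).norm x y =
      x 0 * y 1 + x 1 * y 0 + x 2 * y 5 + x 5 * y 2 + x 3 * y 6 + x 6 * y 3
        + x 4 * y 7 + x 7 * y 4 := by
  simp only [QuadraticMap.polar, pseudoOctonion_norm, Pi.add_apply]
  ring

theorem pseudoOctonion_isSymmComposition (L : Type u) [Field L] :
    (pseudoOctonion L).IsSymmComposition where
  mul_mul_self x y := by
    ext l
    fin_cases l <;> simp [pseudoOctonion_mul, pseudoOctonion_norm] <;> ring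
  self_mul_mul x y := by
    ext l
    fin_cases l <;> simp [pseudoOctonion_mul, pseudoOctonion_norm] <;> ring
  polar_mul x y z := by
    simp [pseudoOctonion_mul, pseudoOctonion_polar]
    ring
  norm_mul x y := by
    simp [pseudoOctonion_mul, pseudoOctonion_norm]
    ring
  nondegenerate x hx := by
    ext l
    fin_cases l
    · simpa [pseudoOctonion_polar] using hx (Pi.single 1 1)
    · simpa [pseudoOctonion_polar] using hx (Pi.single 0 1)
    · simpa [pseudoOctonion_polar] using hx (Pi.single 5 1)
    · simpa [pseudoOctonion_polar] using hx (Pi.single 6 1)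
    · simpa [pseudoOctonion_polar] using hx (Pi.single 7 1)
    · simpa [pseudoOctonion_polar] using hx (Pi.single 2 1)
    · simpa [pseudoOctonion_polar] using hx (Pi.single 3 1)
    · simpa [pseudoOctonion_polar] using hx (Pi.single 4 1)

/-- The maps `x ↦ c * x - x * c` are derivations of the pseudo-octonion algebra. -/
theorem pseudoOctonion_derivation {L : Type u} [Field L] (c x y : Fin 8 → L) :
    (pseudoOctonion L).mul c ((pseudoOctonion L).mul x y)
        - (pseudoOctonion L).mul ((pseudoOctonion L).mul x y) c =
      (pseudoOctonion L).mul ((pseudoOctonion L).mul c x - (pseudoOctonion L).mul x c) y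
        + (pseudoOctonion L).mul x ((pseudoOctonion L).mul c y - (pseudoOctonion L).mul y c) := by
  ext l
  fin_cases l <;> simp [pseudoOctonion_mul] <;> ring

/-- Only `0` commutes with all elements of the pseudo-octonion algebra. -/
theorem pseudoOctonion_center {L : Type u} [Field L] (c : Fin 8 → L)
    (hc : ∀ x, (pseudoOctonion L).mul c x = (pseudoOctonion L).mul x c) : c = 0 := by
  have h2 := hc (Pi.single 2 1)
  have h5 := hc (Pi.single 5 1)
  have h3 := hc (Pi.single 3 1)
  simp [pseudoOctonion_mul] at h2 h3 h5
  ext l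
  fin_cases l <;> simp [h2, h3]

/-! ### Transfer of properties between Okubo algebras and pseudo-octonion algebras -/

theorem IsOkubo.finrank_eq (hA : A.IsOkubo) : Module.finrank k S = 8 := by
  obtain ⟨L, _, _, φ, -, -⟩ := hA
  have h := φ.finrank_eq
  rw [Module.finrank_baseChange] at h
  simpa using h

/-- An Okubo algebra embeds into some `P₈(L)` as the set of elements `1 ⊗ x`, which spans `P₈(L)`
over `L`. The map is semilinear for the inclusion `i` of `k` in `L`. -/
theorem IsOkubo.exists_embedding (hA : A.IsOkubo) :
    ∃ (L : Type u) (_ : Field L) (i : k →+* L) (ι : S →+ (Fin 8 → L)),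
      Function.Injective ι ∧ Submodule.span L (Set.range ι) = ⊤ ∧
      (∀ (c : k) (x : S), ι (c • x) = i c • ι x) ∧
      (∀ x y : S, ι (x ⋆ y) = (pseudoOctonion L).mul (ι x) (ι y)) ∧
      ∀ x : S, (pseudoOctonion L).norm (ι x) = i (A.norm x) := by
  obtain ⟨L, _, _, φ, hm, hn⟩ := hA
  let ι : S →+ (Fin 8 → L) :=
    φ.toLinearMap.toAddMonoidHom.comp (TensorProduct.mk k L S 1).toAddMonoidHom
  have hι : ∀ x, ι x = φ (1 ⊗ₜ[k] x) := fun x => rfl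
  refine ⟨L, inferInstance, algebraMap k L, ι, ?_, ?_, fun c x => ?_, hm, hn⟩
  · intro x y hxy
    rw [hι, hι] at hxy
    exact Module.Flat.rTensor_preserves_injective_linearMap (M := S) (Algebra.linearMap k L)
      (FaithfulSMul.algebraMap_injective k L) |>.comp (TensorProduct.lid k S).symm.injective
      (by simpa using φ.injective hxy)
  · rw [eq_top_iff]
    intro y _
    obtain ⟨t, rfl⟩ := φ.surjective y
    induction t with
    | zero => simp
    | tmul l x =>
      have : l ⊗ₜ[k] x = l • ((1 : L) ⊗ₜ[k] x) := by simp [TensorProduct.smul_tmul']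
      rw [this, map_smul]
      exact Submodule.smul_mem _ _ (Submodule.subset_span ⟨x, rfl⟩)
    | add a b ha hb => rw [map_add]; exact Submodule.add_mem _ (ha trivial) (hb trivial)
  · rw [hι, hι, ← map_smul, TensorProduct.tmul_smul, algebraMap_smul]

theorem IsOkubo.isSymmComposition (hA : A.IsOkubo) : A.IsSymmComposition := by
  obtain ⟨L, _, i, ι, hinj, hspan, hsmul, hmul, hnorm⟩ := hA.exists_embedding
  have P := pseudoOctonion_isSymmComposition L
  have hpol : ∀ x y, QuadraticMap.polar (pseudoOctonion L).norm (ι x) (ι y) = i ⟪x, y⟫ :=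
    fun x y => by simp only [QuadraticMap.polar, ← map_add, hnorm, map_sub]
  refine ⟨fun x y => hinj ?_, fun x y => hinj ?_, fun x y z => i.injective ?_,
    fun x y => i.injective ?_, fun x hx => hinj ?_⟩
  · rw [hmul, hmul, hsmul, P.mul_mul_self, hnorm]
  · rw [hmul, hmul, hsmul, P.self_mul_mul, hnorm]
  · rw [← hpol, ← hpol, hmul, hmul, P.polar_mul]
  · rw [map_mul, ← hnorm, ← hnorm, ← hnorm, hmul, P.norm_mul]
  · rw [map_zero]
    refine P.nondegenerate _ fun y => ?_
    have hy : y ∈ Submodule.span L (Set.range ι) := hspan ▸ trivial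
    induction hy using Submodule.span_induction with
    | mem y hy => obtain ⟨y, rfl⟩ := hy; rw [hpol, hx, map_zero]
    | zero => simp
    | add y z _ _ hy hz => rw [QuadraticMap.polar_add_right, hy, hz, add_zero]
    | smul c y _ hy => rw [QuadraticMap.polar_smul_right, hy, smul_zero]

theorem IsOkubo.derivation (hA : A.IsOkubo) (c x y : S) :
    c ⋆ (x ⋆ y) - (x ⋆ y) ⋆ c = (c ⋆ x - x ⋆ c) ⋆ y + x ⋆ (c ⋆ y - y ⋆ c) := by
  obtain ⟨L, _, i, ι, hinj, -, -, hmul, -⟩ := hA.exists_embedding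
  apply hinj
  have h := pseudoOctonion_derivation (ι c) (ι x) (ι y)
  simp only [map_sub, LinearMap.sub_apply] at h
  simpa only [map_add, map_sub, LinearMap.sub_apply, hmul] using h

theorem IsOkubo.center (hA : A.IsOkubo) (c : S) (hc : ∀ x, c ⋆ x = x ⋆ c) : c = 0 := by
  obtain ⟨L, _, i, ι, hinj, hspan, -, hmul, -⟩ := hA.exists_embedding
  apply hinj
  rw [map_zero]
  refine pseudoOctonion_center _ fun y => ?_
  have hy : y ∈ Submodule.span L (Set.range ι) := hspan ▸ trivial
  induction hy using Submodule.span_induction with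
  | mem y hy => obtain ⟨y, rfl⟩ := hy; rw [← hmul, hc, hmul]
  | zero => simp
  | add y z _ _ hy hz => simp [hy, hz]
  | smul c y _ hy => simp [hy]

theorem okuboO_map_mul {k L : Type*} [Field k] [Field L] (i : k →+* L) (α β : k)
    (x y : Fin 8 → k) :
    i ∘ (okuboO α β).mul x y = (okuboO (i α) (i β)).mul (i ∘ x) (i ∘ y) := by
  have hT : ∀ p q l, i (okuboTable α β p q l) = okuboTable (i α) (i β) p q l := by
    intro p q l
    fin_cases p <;> fin_cases q <;> simp [okuboTable, Pi.single_apply, apply_ite i]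
  ext l
  simp [okuboO, tableMul, hT]

/-- `P₈(L) ≅ O_{1,γ³}`, by the generating pair `-e₁, -γ u₁`. -/
theorem pseudoOctonion_isIsomorphic {L : Type u} [Field L] {γ : L} (hγ : γ ≠ 0) :
    (pseudoOctonion L).IsIsomorphic (okuboO 1 (γ ^ 3)) := by
  have P := pseudoOctonion_isSymmComposition L
  refine (P.generatingPair (a := -Pi.single 0 1) (b := -γ • Pi.single 2 1) one_ne_zero
    (pow_ne_zero 3 hγ) ?_ ?_ ?_ ?_ ?_ ?_).isIsomorphic_okuboO P (by simp)
  · simp [pseudoOctonion_norm]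
  · simp [pseudoOctonion_norm]
  · simp [cubicForm, pseudoOctonion_polar, pseudoOctonion_mul]
  · simp [cubicForm, pseudoOctonion_polar, pseudoOctonion_mul]
    ring
  · ext l
    fin_cases l <;> simp [pseudoOctonion_mul]
  · simp [pseudoOctonion_polar]

/-- Over an algebraically closed field `β` becomes a cube, and `O_{1,β}` becomes isomorphic to `P₈`.
-/
theorem IsIsomorphic.isOkubo {β : k} (hβ : β ≠ 0) (h : A.IsIsomorphic (okuboO 1 β)) :
    A.IsOkubo := by
  obtain ⟨f, hmul, hnorm⟩ := h
  let L := AlgebraicClosure k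
  obtain ⟨γ, hγ⟩ := IsAlgClosed.exists_pow_nat_eq (algebraMap k L β) (n := 3) (by norm_num)
  have hγ0 : γ ≠ 0 := by
    rintro rfl
    exact hβ (by simpa using hγ.symm)
  obtain ⟨g, gmul, gnorm⟩ := pseudoOctonion_isIsomorphic hγ0
  let φ : (L ⊗[k] S) ≃ₗ[L] (Fin 8 → L) :=
    f.baseChange k L _ _ ≪≫ₗ TensorProduct.piScalarRight k L L (Fin 8) ≪≫ₗ g.symm
  have hφ : ∀ x, φ (1 ⊗ₜ[k] x) = g.symm (algebraMap k L ∘ f x) := fun x => by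
    simp only [φ, LinearEquiv.trans_apply]
    congr 1
    ext l
    simp [Algebra.smul_def]
  refine ⟨L, inferInstance, inferInstance, φ, fun x y => ?_, fun x => ?_⟩
  · rw [hφ, hφ, hφ, hmul, okuboO_map_mul, LinearEquiv.symm_apply_eq, gmul, hγ, map_one,
      g.apply_symm_apply, g.apply_symm_apply]
  · rw [hφ, ← gnorm, g.apply_symm_apply, ← hnorm]
    simp [okuboO]

theorem IsIsomorphic.hasIsotropicNorm {β : k} (h : A.IsIsomorphic (okuboO 1 β)) :
    A.HasIsotropicNorm := by
  obtain ⟨f, hmul, hnorm⟩ := h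
  refine ⟨f.symm (Pi.single 0 1), by simp, ?_⟩
  rw [← hnorm, f.apply_symm_apply]
  simp [okuboO]

/-- The idempotent is `-(x_{1,0} + x_{-1,0})`. -/
theorem IsIsomorphic.hasNonzeroIdempotent {β : k} (h : A.IsIsomorphic (okuboO 1 β)) :
    A.HasNonzeroIdempotent := by
  obtain ⟨f, hmul, hnorm⟩ := h
  refine ⟨f.symm (-(Pi.single 0 1 + Pi.single 1 1)), ?_, ?_⟩
  · rw [Ne, LinearEquiv.map_eq_zero_iff, neg_eq_zero]
    intro h
    simpa using congrFun h 0
  · rw [LinearEquiv.eq_symm_apply, hmul, f.apply_symm_apply]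
    ext l
    simp [okuboO, tableMul, Fin.sum_univ_eight, okuboTable]
    fin_cases l <;> simp

/-! ### Idempotents, inner derivations, and isotropic elements outside characteristic three -/

variable (A) in
/-- The commutator `x ↦ c * x - x * c`. -/
def ad (c : S) : S →ₗ[k] S := A.mul c - A.mul.flip c

variable (A) in
/-- All maps `ad c` are derivations. -/
def AdIsDerivation : Prop := ∀ c x y : S, A.ad c (x ⋆ y) = A.ad c x ⋆ y + x ⋆ A.ad c y

theorem ad_apply (c x : S) : A.ad c x = c ⋆ x - x ⋆ c := rfl

namespace IsSymmComposition

theorem polar_mul_self (H : A.IsSymmComposition) (x y z : S) :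
    ⟪x, y ⋆ z⟫ = ⟪z, x ⋆ y⟫ := by
  rw [← H.polar_mul, QuadraticMap.polar_comm]

theorem cubicForm_add (H : A.IsSymmComposition) (x y : S) :
    A.cubicForm (x + y) =
      A.cubicForm x + A.cubicForm y + 3 * ⟪y, x ⋆ x⟫ + 3 * ⟪x, y ⋆ y⟫ := by
  simp only [cubicForm, map_add, LinearMap.add_apply, QuadraticMap.polar_add_left,
    QuadraticMap.polar_add_right]
  linear_combination 2 * H.polar_mul_self x x y + H.polar_mul_self x y x +
    2 * H.polar_mul_self y y x + H.polar_mul_self y x y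

theorem ad_polar (H : A.IsSymmComposition) (c x y : S) : ⟪A.ad c x, y⟫ = -⟪x, A.ad c y⟫ := by
  simp only [ad_apply, QuadraticMap.polar_sub_left, QuadraticMap.polar_sub_right, H.polar_mul]
  linear_combination H.polar_mul_self c x y + H.polar_mul_self y c x

section Idempotent
variable {e : S}

theorem norm_idempotent (H : A.IsSymmComposition) (he : e ⋆ e = e) (he0 : e ≠ 0) :
    A.norm e = 1 := by
  have h := H.mul_mul_self e e
  rw [he, he] at h
  have : (A.norm e - 1) • e = 0 := by rw [sub_smul, ← h, one_smul, sub_self]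
  exact sub_eq_zero.1 ((smul_eq_zero.1 this).resolve_right he0)

theorem idempotent_mul_mul (H : A.IsSymmComposition) (he : e ⋆ e = e) (x : S) :
    e ⋆ (e ⋆ x) = ⟪e, x⟫ • e - x ⋆ e := by
  have := H.mul_add_mul e e x
  rw [he] at this
  exact eq_sub_of_add_eq this

theorem mul_idempotent_mul (H : A.IsSymmComposition) (he : e ⋆ e = e) (x : S) :
    (x ⋆ e) ⋆ e = ⟪e, x⟫ • e - e ⋆ x := by
  have := H.mul_mul_add e e x
  rw [he, add_comm] at this
  exact eq_sub_of_add_eq this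

theorem ad_ad (H : A.IsSymmComposition) (he : e ⋆ e = e) (hn : A.norm e = 1) (x : S) :
    A.ad e (A.ad e x) = (2 * ⟪e, x⟫) • e - e ⋆ x - x ⋆ e - (2 : k) • x := by
  simp only [ad_apply, map_sub, H.idempotent_mul_mul he, H.mul_idempotent_mul he, H.self_mul_mul,
    H.mul_mul_self, hn]
  module

theorem ad_self (x : S) : A.ad x x = 0 := by rw [ad_apply, sub_self]

theorem ad_ad_ad (H : A.IsSymmComposition) (he : e ⋆ e = e) (hn : A.norm e = 1) (x : S) :
    A.ad e (A.ad e (A.ad e x)) = -((3 : k) • A.ad e x) := by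
  have h0 : ⟪e, A.ad e x⟫ = 0 := by
    rw [QuadraticMap.polar_comm, H.ad_polar, ad_self, QuadraticMap.polar_zero_right, neg_zero]
  rw [H.ad_ad he hn, h0]
  simp only [ad_apply, map_sub, LinearMap.sub_apply, H.idempotent_mul_mul he,
    H.mul_idempotent_mul he, H.self_mul_mul, H.mul_mul_self, hn]
  module

/-- If `w` commutes with `e`, then `e * w = n(e, w) e - w`; if moreover `w` is isotropic and
`n(e, w) = -1`, then `w * w = e + w`. -/
theorem cubicForm_of_ad_eq_zero (H : A.IsSymmComposition) (he : e ⋆ e = e) (hn : A.norm e = 1)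
    {w : S} (hw : A.ad e w = 0) (hnw : A.norm w = 0) (hwe : ⟪e, w⟫ = -1) :
    A.cubicForm w = -1 := by
  have hc : e ⋆ w = w ⋆ e := sub_eq_zero.1 hw
  have h1 : e ⋆ w = -e - w := by
    have := H.idempotent_mul_mul he w
    rw [hc, H.self_mul_mul, hn, hwe] at this
    rw [hc]
    linear_combination (norm := module) this
  have h2 : w ⋆ (e ⋆ w) = 0 := by rw [H.self_mul_mul, hnw, zero_smul]
  rw [h1, map_sub, map_neg, ← hc, h1] at h2
  have h3 : w ⋆ w = e + w := by linear_combination (norm := module) -h2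
  rw [cubicForm, h3, QuadraticMap.polar_add_right, QuadraticMap.polar_comm, hwe, polar_self_eq, hnw]
  ring

/-- The derivation `ad c` annihilates the invariant form `n(x, y * y)`. -/
theorem polar_ad_sq (H : A.IsSymmComposition) (hd : A.AdIsDerivation) (c x y : S) :
    ⟪A.ad c x, y ⋆ y⟫ + ⟪x, A.ad c y ⋆ y⟫ + ⟪x, y ⋆ A.ad c y⟫ = 0 := by
  rw [H.ad_polar, hd c, QuadraticMap.polar_add_right]
  ring

theorem polar_ad_self (H : A.IsSymmComposition) (hd : A.AdIsDerivation) (h3 : (3 : k) ≠ 0)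
    (c x : S) :
    ⟪A.ad c x, x ⋆ x⟫ = 0 := by
  have h := H.polar_ad_sq hd c x x
  rw [H.polar_mul_self x, H.polar_mul_self x] at h
  exact (mul_eq_zero.1 (by linear_combination h : (3 : k) * ⟪A.ad c x, x ⋆ x⟫ = 0)).resolve_left h3

/-- The cubic form vanishes on the part of the algebra where `(ad c)² = -3`. -/
theorem cubicForm_of_ad_ad (H : A.IsSymmComposition) (hd : A.AdIsDerivation) (h3 : (3 : k) ≠ 0)
    {c y : S} (hy : A.ad c (A.ad c y) = -((3 : k) • y)) : A.cubicForm y = 0 := by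
  have h1 := H.polar_ad_sq hd c (A.ad c y) y
  have h2 := H.polar_ad_self hd h3 c (A.ad c y)
  rw [hy, QuadraticMap.polar_neg_left, QuadraticMap.polar_smul_left, smul_eq_mul, neg_eq_zero,
    mul_eq_zero, or_iff_right h3] at h2
  rw [hy, QuadraticMap.polar_neg_left, QuadraticMap.polar_smul_left, smul_eq_mul] at h1
  have h4 := H.polar_mul_self (A.ad c y) (A.ad c y) y
  have h5 := H.polar_mul_self (A.ad c y) y (A.ad c y)
  rw [cubicForm]
  exact (mul_eq_zero.1
    (by linear_combination -h1 + h5 + 2 * h4 + 2 * h2 : (3 : k) * ⟪y, y ⋆ y⟫ = 0)).resolve_left h3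

/-- The element `a` is `e + y`. -/
theorem exists_of_ad_ad (H : A.IsSymmComposition) (hd : A.AdIsDerivation) (h3 : (3 : k) ≠ 0)
    (he : e ⋆ e = e) (hn : A.norm e = 1) {y : S} (hy : A.ad e (A.ad e y) = -((3 : k) • y))
    (hny : A.norm y = -1) :
    ∃ a, A.norm a = 0 ∧ A.cubicForm a = -1 := by
  have hey : ⟪e, y⟫ = 0 := by
    have h : ⟪e, A.ad e (A.ad e y)⟫ = 0 := by
      rw [QuadraticMap.polar_comm, H.ad_polar, ad_self, QuadraticMap.polar_zero_right, neg_zero]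
    rw [hy, QuadraticMap.polar_neg_right, QuadraticMap.polar_smul_right, smul_eq_mul, neg_eq_zero,
      mul_eq_zero, or_iff_right h3] at h
    exact h
  have hsum : e ⋆ y + y ⋆ e = y := by
    have h := H.ad_ad he hn y
    rw [hy, hey] at h
    linear_combination (norm := module) h
  have hp : ⟪e, y ⋆ y⟫ = A.norm y := by
    have h1 : A.norm (e ⋆ y + y ⋆ e) = A.norm y := by rw [hsum]
    have h2 : ⟪e ⋆ y, e ⋆ y + y ⋆ e⟫ = ⟪e ⋆ y, y⟫ := by rw [hsum]
    rw [norm_add, H.norm_mul, H.norm_mul, hn] at h1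
    rw [QuadraticMap.polar_add_right, polar_self_eq, H.norm_mul, hn] at h2
    rw [← H.polar_mul]
    linear_combination h1 - h2
  refine ⟨e + y, by rw [norm_add, hn, hny, hey]; ring, ?_⟩
  rw [H.cubicForm_add, H.cubicForm_of_ad_ad hd h3 hy, hp, he, QuadraticMap.polar_comm, hey, hny,
    cubicForm, he, polar_self_eq, hn]
  ring

/-- Outside characteristic three, an isotropic norm and an idempotent give an isotropic element `a`
with `g(a) = -1`. The proof decomposes an isotropic vector `z` as `h + y` in
`ker (ad e) ⊕ ker ((ad e)² + 3)`. -/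
theorem exists_cubicForm_eq_neg_one (H : A.IsSymmComposition) (hd : A.AdIsDerivation)
    (h3 : (3 : k) ≠ 0) (hi : A.HasIsotropicNorm) (he : e ⋆ e = e) (hn : A.norm e = 1) :
    ∃ a, A.norm a = 0 ∧ A.cubicForm a = -1 := by
  obtain ⟨z, hz0, hz⟩ := hi
  have hker : ∀ s : S, A.ad e (s + (3 : k)⁻¹ • A.ad e (A.ad e s)) = 0 := fun s => by
    rw [map_add, map_smul, H.ad_ad_ad he hn, smul_neg, smul_smul, inv_mul_cancel₀ h3, one_smul,
      add_neg_cancel]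
  have him : ∀ s : S, A.ad e (A.ad e (-((3 : k)⁻¹ • A.ad e (A.ad e s)))) =
      -((3 : k) • -((3 : k)⁻¹ • A.ad e (A.ad e s))) := fun s => by
    rw [map_neg, map_neg, map_smul, map_smul, H.ad_ad_ad he hn]
    module
  obtain ⟨h, hh⟩ : ∃ h, h = z + (3 : k)⁻¹ • A.ad e (A.ad e z) := ⟨_, rfl⟩
  obtain ⟨y, hy⟩ : ∃ y, y = -((3 : k)⁻¹ • A.ad e (A.ad e z)) := ⟨_, rfl⟩
  have hzy : z = h + y := by rw [hh, hy]; abel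
  have hh0 : A.ad e h = 0 := by rw [hh]; exact hker z
  have hyy : A.ad e (A.ad e y) = -((3 : k) • y) := by rw [hy]; exact him z
  have hhy : ⟪h, y⟫ = 0 := by
    rw [hy, QuadraticMap.polar_neg_right, QuadraticMap.polar_smul_right,
      ← neg_eq_iff_eq_neg.2 (H.ad_polar e h _), hh0]
    simp
  have hnz : A.norm h + A.norm y = 0 := by rw [← hz, hzy, norm_add, hhy, add_zero]
  by_cases hnh : A.norm h = 0
  · by_cases h0 : h = 0
    · -- an isotropic vector of `ker ((ad e)² + 3)` spans a hyperbolic plane within that space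
      have hy0 : y ≠ 0 := by rintro rfl; apply hz0; rw [hzy, h0, add_zero]
      have hny : A.norm y = 0 := by rwa [hnh, zero_add] at hnz
      obtain ⟨s, hs⟩ : ∃ s, ⟪y, s⟫ ≠ 0 := by
        by_contra! hs
        exact hy0 (H.nondegenerate y hs)
      obtain ⟨t, ht⟩ : ∃ t, t = -((3 : k)⁻¹ • A.ad e (A.ad e s)) := ⟨_, rfl⟩
      have htt : A.ad e (A.ad e t) = -((3 : k) • t) := by rw [ht]; exact him s
      have hyt : ⟪y, t⟫ = ⟪y, s⟫ := by
        rw [ht, QuadraticMap.polar_neg_right, QuadraticMap.polar_smul_right,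
          ← neg_eq_iff_eq_neg.2 (H.ad_polar e y _), ← neg_eq_iff_eq_neg.2 (H.ad_polar e _ s), hyy,
          QuadraticMap.polar_neg_left, QuadraticMap.polar_smul_left]
        simp [h3]
      refine H.exists_of_ad_ad hd h3 he hn (y := t + ((-1 - A.norm t) / ⟪y, s⟫) • y) ?_ ?_
      · simp only [map_add, map_smul, htt, hyy]
        module
      · rw [norm_add, QuadraticMap.map_smul, hny, QuadraticMap.polar_smul_right,
          QuadraticMap.polar_comm _ t, hyt, smul_eq_mul, smul_eq_mul, div_mul_cancel₀ _ hs]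
        ring
    · -- `ker (ad e)` is a subalgebra on which the norm is isotropic and nondegenerate
      obtain ⟨s, hs⟩ : ∃ s, ⟪h, s⟫ ≠ 0 := by
        by_contra! hs
        exact h0 (H.nondegenerate h hs)
      obtain ⟨x, hx⟩ : ∃ x, x = s + (3 : k)⁻¹ • A.ad e (A.ad e s) := ⟨_, rfl⟩
      have hx0 : A.ad e x = 0 := by rw [hx]; exact hker s
      have hhx : ⟪h, x⟫ = ⟪h, s⟫ := by
        rw [hx, QuadraticMap.polar_add_right, QuadraticMap.polar_smul_right,
          ← neg_eq_iff_eq_neg.2 (H.ad_polar e h _), hh0]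
        simp
      refine ⟨-(⟪h, s⟫⁻¹ • (h ⋆ (e ⋆ x))), ?_, H.cubicForm_of_ad_eq_zero he hn ?_ ?_ ?_⟩
      · simp [QuadraticMap.map_smul, H.norm_mul, hnh]
      · simp [hd e, hh0, hx0, ad_self]
      · simp [QuadraticMap.map_smul, H.norm_mul, hnh]
      · rw [QuadraticMap.polar_neg_right, QuadraticMap.polar_smul_right, QuadraticMap.polar_comm _ e,
          H.polar_mul, H.mul_mul_self, hn, one_smul, hhx, smul_eq_mul, inv_mul_cancel₀ hs]
  · -- multiplication by `h` preserves `ker ((ad e)² + 3)` and scales the norm by `n(h) = -n(y)`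
    refine H.exists_of_ad_ad hd h3 he hn (y := (A.norm h)⁻¹ • (h ⋆ y)) ?_ ?_
    · simp only [map_smul, hd e, hh0, hyy, map_zero, LinearMap.zero_apply, zero_add, map_neg]
      module
    · rw [QuadraticMap.map_smul, H.norm_mul, ← neg_eq_iff_add_eq_zero.2 hnz, smul_eq_mul]
      field_simp

end Idempotent
end IsSymmComposition

/-! ### A volume form with an automorphism of order three -/

/-- Let `vol` be a nonzero alternating trilinear form invariant under `T`, where `T³ = 1` and `T`
and `T²` act on `vol` with trace zero. Outside characteristic three some orbit `b, Tb, T²b` has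
nonzero volume. Each vector is a sum of a vector `f` fixed by `T` and a vector `n` in the kernel of
`1 + T + T²`; only volumes of type `vol(f, n, n')` can be nonzero, and
`vol(b, Tb, T²b) = 3 vol(f, n, Tn)` for `b = f + n`. -/
theorem exists_volume_orbit_ne_zero {k V : Type*} [Field k] [AddCommGroup V] [Module k V]
    (h3 : (3 : k) ≠ 0) (T : V →ₗ[k] V) (vol : V → V → V → k)
    (hT : ∀ x, T (T (T x)) = x)
    (hadd : ∀ x x' y z, vol (x + x') y z = vol x y z + vol x' y z)
    (hsmul : ∀ (c : k) x y z, vol (c • x) y z = c * vol x y z)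
    (hs₁ : ∀ x y z, vol y x z = -vol x y z) (hs₂ : ∀ x y z, vol x z y = -vol x y z)
    (halt : ∀ x y, vol x x y = 0)
    (hinv : ∀ x y z, vol (T x) (T y) (T z) = vol x y z)
    (htr : ∀ x y z, vol (T x) y z + vol x (T y) z + vol x y (T z) = 0)
    (htr2 : ∀ x y z, vol (T (T x)) y z + vol x (T (T y)) z + vol x y (T (T z)) = 0)
    (hne : ∃ x y z, vol x y z ≠ 0) : ∃ b, vol b (T b) (T (T b)) ≠ 0 := by
  have hadd₂ : ∀ x y y' z, vol x (y + y') z = vol x y z + vol x y' z := fun x y y' z => by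
    rw [hs₁, hadd, neg_add, ← hs₁, ← hs₁]
  have hadd₃ : ∀ x y z z', vol x y (z + z') = vol x y z + vol x y z' := fun x y z z' => by
    rw [hs₂, hadd₂, neg_add, ← hs₂, ← hs₂]
  have hsmul₂ : ∀ (c : k) x y z, vol x (c • y) z = c * vol x y z := fun c x y z => by
    rw [hs₁, hsmul, ← mul_neg, ← hs₁]
  have hsmul₃ : ∀ (c : k) x y z, vol x y (c • z) = c * vol x y z := fun c x y z => by
    rw [hs₂, hsmul₂, ← mul_neg, ← hs₂]
  have hcyc : ∀ x y z, vol y z x = vol x y z := fun x y z => by rw [hs₂, hs₁, neg_neg]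
  have hzero : ∀ x y, vol x y 0 = 0 := fun x y => by simpa using hsmul₃ 0 x y 0
  have cancel : ∀ c : k, 3 * c = 0 → c = 0 := fun c hc => (mul_eq_zero.1 hc).resolve_left h3
  have hFFF : ∀ f f' f'', T f = f → T f' = f' → T f'' = f'' → vol f f' f'' = 0 := by
    intro f f' f'' h h' h''
    apply cancel
    have := htr f f' f''
    rw [h, h', h''] at this
    linear_combination this
  have hFFN : ∀ f f' n, T f = f → T f' = f' → n + T n + T (T n) = 0 → vol f f' n = 0 := by
    intro f f' n h h' hn
    apply cancel
    have h1 := hinv f f' n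
    have h2 := hinv f f' (T n)
    have h3 := hzero f f'
    rw [h, h'] at h1 h2
    rw [← hn, hadd₃, hadd₃] at h3
    linear_combination h3 - 2 * h1 - h2
  have hNNN : ∀ m n p, m + T m + T (T m) = 0 → n + T n + T (T n) = 0 → p + T p + T (T p) = 0 →
      vol m n p = 0 := by
    intro m n p hm hn hp
    apply cancel
    have e1 := hzero n p
    have e2 := hzero p m
    have e3 := hzero m n
    rw [← hm, hadd₃, hadd₃] at e1
    rw [← hn, hadd₃, hadd₃] at e2
    rw [← hp, hadd₃, hadd₃] at e3
    rw [← hcyc p m, ← hcyc p m, ← hcyc p m] at e2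
    linear_combination e1 + e2 + e3 - htr m n p - htr2 m n p - hcyc m n p - hcyc (T m) n p -
      hcyc (T (T m)) n p
  by_cases key : ∃ f n, T f = f ∧ n + T n + T (T n) = 0 ∧ vol f n (T n) ≠ 0
  · obtain ⟨f, n, hf, hn, hfn⟩ := key
    refine ⟨f + n, ?_⟩
    have hTn : n + T n + T (T n) = 0 → T n + T (T n) + T (T (T n)) = 0 := fun h => by
      rw [← map_add, ← map_add, h, map_zero]
    have e1 := hNNN n (T n) (T (T n)) hn (hTn hn) (by rw [← map_add, ← map_add, hTn hn, map_zero])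
    have e2 : vol f (T n) (T (T n)) = vol f n (T n) := by rw [← hinv f n, hf]
    have e3 := hzero f n
    rw [← hn, hadd₃, hadd₃, ← hcyc f n n, halt] at e3
    have e4 := hFFF f f f hf hf hf
    have e5 : vol f f (T (T n)) = 0 := halt _ _
    have e6 : vol f (T n) f = 0 := by rw [hs₂, halt, neg_zero]
    have e7 : vol n f f = 0 := by rw [← hcyc, halt]
    have e8 : vol (f + n) (f + T n) (f + T (T n)) = 3 * vol f n (T n) := by
      simp only [hadd, hadd₂, hadd₃, e1, e2, e4, e5, e6, e7, hs₁ f n, ← hcyc f n (T n)]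
      rw [hcyc]
      linear_combination -e3
    rw [map_add, map_add, hf, hf, e8]
    exact mul_ne_zero h3 hfn
  · push Not at key
    exfalso
    obtain ⟨x, y, z, hxyz⟩ := hne
    -- if `vol(f, n, Tn) = 0` throughout, polarization gives `vol(f, m, Tn) = vol(f, m, n)`, and
    -- summing over `n, Tn, T²n` gives `3 vol(f, m, n) = 0`
    have hFNN : ∀ f m n, T f = f → m + T m + T (T m) = 0 → n + T n + T (T n) = 0 →
        vol f m n = 0 := by
      intro f m n hf hm hn
      have pol : ∀ p q, p + T p + T (T p) = 0 → q + T q + T (T q) = 0 →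
          vol f p (T q) = vol f (T p) q := by
        intro p q hp hq
        have := key f (p + q) hf (by
          simp only [map_add]
          linear_combination (norm := module) hp + hq)
        rw [map_add, hadd₂, hadd₃, hadd₃, key f p hf hp, key f q hf hq] at this
        rw [hs₂ f q (T p)]
        linear_combination this
      have hTn : T n + T (T n) + T (T (T n)) = 0 := by rw [← map_add, ← map_add, hn, map_zero]
      have i1 : vol f m (T (T n)) = vol f m n := by
        rw [pol m (T n) hm hTn, ← hinv f m n, hf]
      have i2 : vol f m (T n) = vol f m n := by
        rw [← hinv f m (T n), hf, ← pol m (T (T n)) hm (by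
          rw [← map_add, ← map_add, hTn, map_zero]), hT]
      apply cancel
      have i3 := hzero f m
      rw [← hn, hadd₃, hadd₃, i1, i2] at i3
      linear_combination i3
    apply hxyz
    have dec : ∀ x, ∃ f n, T f = f ∧ n + T n + T (T n) = 0 ∧ (3 : k) • x = f + n := fun x => by
      refine ⟨x + T x + T (T x), (3 : k) • x - (x + T x + T (T x)), ?_, ?_, by abel⟩
      · simp only [map_add, hT]; abel
      · simp only [map_add, map_sub, map_smul, hT]; module
    obtain ⟨f₁, n₁, hf₁, hn₁, e₁⟩ := dec x
    obtain ⟨f₂, n₂, hf₂, hn₂, e₂⟩ := dec y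
    obtain ⟨f₃, n₃, hf₃, hn₃, e₃⟩ := dec z
    apply cancel; apply cancel; apply cancel
    rw [← hsmul, ← hsmul₂, ← hsmul₃, e₁, e₂, e₃]
    simp only [hadd, hadd₂, hadd₃]
    rw [hFFF _ _ _ hf₁ hf₂ hf₃, hFFN _ _ _ hf₁ hf₂ hn₃, hFNN _ _ _ hf₁ hn₂ hn₃,
      hNNN _ _ _ hn₁ hn₂ hn₃, hs₂ f₁ f₃ n₂, hFFN _ _ _ hf₁ hf₃ hn₂, ← hcyc n₁ f₂ f₃,
      hFFN _ _ _ hf₂ hf₃ hn₁, ← hcyc n₁ f₂ n₃, hFNN _ _ _ hf₂ hn₃ hn₁, hcyc f₃ n₁ n₂,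
      hFNN _ _ _ hf₃ hn₁ hn₂]
    simp

/-! ### Peirce decomposition -/

variable (A) in
/-- Isotropic elements `a, a'` with `a * a = -a'`, `a' * a' = -a`, `a * a' = 0 = a' * a` and
`n(a, a') = 1`. Then `-(a + a')` is an idempotent, and `-a`, `-a'` are the orthogonal primitive
idempotents of a subalgebra `k × k` of the associated Cayley algebra. -/
structure SplitPair (a a' : S) : Prop where
  norm_left : A.norm a = 0
  norm_right : A.norm a' = 0
  left_mul_left : a ⋆ a = -a'
  right_mul_right : a' ⋆ a' = -a
  left_mul_right : a ⋆ a' = 0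
  right_mul_left : a' ⋆ a = 0
  polar_eq : ⟪a, a'⟫ = 1

variable (A) in
/-- Membership in the Peirce space of a split pair `a, a'`. The opposite Peirce space is obtained by
exchanging `a` and `a'`. -/
structure IsPeirce (a a' x : S) : Prop where
  left_mul : a ⋆ x = 0
  mul_right : x ⋆ a' = 0
  polar_left : ⟪a, x⟫ = 0
  polar_right : ⟪a', x⟫ = 0

variable {a a' : S}

theorem SplitPair.symm (h : A.SplitPair a a') : A.SplitPair a' a :=
  ⟨h.2, h.1, h.4, h.3, h.6, h.5, by rw [QuadraticMap.polar_comm]; exact h.7⟩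

theorem SplitPair.ne_zero (h : A.SplitPair a a') : a ≠ 0 := by
  rintro rfl
  simpa using h.polar_eq

variable (A) in
/-- The Peirce space as a subspace. -/
def peirce (a a' : S) : Submodule k S where
  carrier := {x | A.IsPeirce a a' x}
  zero_mem' := ⟨by simp, by simp, by simp, by simp⟩
  add_mem' := by
    rintro x y ⟨h1, h2, h3, h4⟩ ⟨h5, h6, h7, h8⟩
    exact ⟨by simp [h1, h5], by simp [h2, h6], by simp [QuadraticMap.polar_add_right, h3, h7],
      by simp [QuadraticMap.polar_add_right, h4, h8]⟩
  smul_mem' := by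
    rintro c x ⟨h1, h2, h3, h4⟩
    exact ⟨by simp [h1], by simp [h2], by simp [QuadraticMap.polar_smul_right, h3],
      by simp [QuadraticMap.polar_smul_right, h4]⟩

namespace IsSymmComposition

/-- An isotropic element `a` with `g(a) = -1` and `a' = -a * a` form a split pair. -/
theorem splitPair (H : A.IsSymmComposition) (ha : A.norm a = 0) (hg : A.cubicForm a = -1) :
    A.SplitPair a (-(a ⋆ a)) := by
  have hg' : ⟪a, a ⋆ a⟫ = -1 := hg
  have hsq : (a ⋆ a) ⋆ (a ⋆ a) = -a := by
    simp [H.sq_mul_sq, ha, hg]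
  constructor <;> simp [H.norm_mul, ha, hg', hsq, H.mul_mul_self, H.self_mul_mul]

theorem isPeirce_of_mul (H : A.IsSymmComposition) (h : A.SplitPair a a') {x : S}
    (h1 : a ⋆ x = 0) (h2 : ⟪a, x⟫ = 0) : A.IsPeirce a a' x := by
  refine ⟨h1, ?_, h2, ?_⟩
  · have := H.mul_add_mul x a a
    rw [h1, h.left_mul_left, QuadraticMap.polar_comm, h2] at this
    simpa using this
  · rw [← neg_neg a', ← h.left_mul_left, QuadraticMap.polar_neg_left, H.polar_mul, h1]
    simp

end IsSymmComposition

namespace SplitPair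

variable {x y z w : S}

theorem norm_peirce (H : A.IsSymmComposition) (h : A.SplitPair a a') (hx : A.IsPeirce a a' x) :
    A.norm x = 0 := by
  have := H.self_mul_mul x a
  rw [hx.left_mul, map_zero] at this
  exact (smul_eq_zero.1 this.symm).resolve_right h.ne_zero

theorem polar_peirce (H : A.IsSymmComposition) (h : A.SplitPair a a') (hx : A.IsPeirce a a' x)
    (hy : A.IsPeirce a a' y) : ⟪x, y⟫ = 0 := by
  rw [QuadraticMap.polar, h.norm_peirce H hx, h.norm_peirce H hy,
    h.norm_peirce H ((A.peirce a a').add_mem hx hy)]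
  simp

theorem isPeirce_mul_left (H : A.IsSymmComposition) (h : A.SplitPair a a')
    (hx : A.IsPeirce a a' x) : A.IsPeirce a a' (x ⋆ a) := by
  apply H.isPeirce_of_mul h
  · rw [H.self_mul_mul, h.norm_left, zero_smul]
  · rw [H.polar_mul_self, hx.left_mul]; simp

/-- On the Peirce space, `x ↦ x * a` has order three (`mul_left_cube`), and its square is
left multiplication by `a'`. -/
theorem right_mul (H : A.IsSymmComposition) (h : A.SplitPair a a')
    (hx : A.IsPeirce a a' x) : a' ⋆ x = (x ⋆ a) ⋆ a := by
  have := H.mul_mul_add x a a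
  rw [h.left_mul_left, QuadraticMap.polar_comm, hx.polar_left] at this
  simp only [map_neg, LinearMap.neg_apply] at this
  linear_combination (norm := module) -this

theorem mul_left_cube (H : A.IsSymmComposition) (h : A.SplitPair a a')
    (hx : A.IsPeirce a a' x) : ((x ⋆ a) ⋆ a) ⋆ a = x := by
  have := H.mul_mul_add a' x a
  rw [hx.left_mul, h.symm.polar_eq, h.right_mul H hx] at this
  simpa using this

/-- Products of two elements of a Peirce space lie in the opposite one. -/
theorem isPeirce_mul (H : A.IsSymmComposition) (h : A.SplitPair a a')
    (hx : A.IsPeirce a a' x) (hy : A.IsPeirce a a' y) : A.IsPeirce a' a (x ⋆ y) := by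
  apply H.isPeirce_of_mul h.symm
  · have := H.mul_add_mul a' x y
    rw [hx.mul_right, hy.polar_right] at this
    simpa using this
  · rw [H.polar_mul_self, H.polar_mul_self, hy.mul_right]; simp

theorem isPeirce_right_mul_mul (H : A.IsSymmComposition) (h : A.SplitPair a a')
    (hx : ⟪a, x⟫ = 0) : A.IsPeirce a a' ((a' ⋆ x) ⋆ a) := by
  apply H.isPeirce_of_mul h
  · rw [H.self_mul_mul, h.norm_left, zero_smul]
  · rw [H.polar_mul_self, ← H.polar_mul, h.left_mul_left, QuadraticMap.polar_neg_left,
      ← H.polar_mul, h.right_mul_right, QuadraticMap.polar_neg_left, hx]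
    simp

/-- Peirce decomposition of the orthogonal complement of `a, a'`. -/
theorem exists_peirce (H : A.IsSymmComposition) (h : A.SplitPair a a')
    (hx : ⟪a, x⟫ = 0) (hx' : ⟪a', x⟫ = 0) :
    ∃ y z, A.IsPeirce a a' y ∧ A.IsPeirce a' a z ∧ x = y + z := by
  refine ⟨_, _, h.isPeirce_right_mul_mul H hx, h.symm.isPeirce_right_mul_mul H hx', ?_⟩
  rw [H.mul_mul_add, h.symm.polar_eq, one_smul]

theorem exists_decomposition (H : A.IsSymmComposition) (h : A.SplitPair a a') (x : S) :
    ∃ y z, A.IsPeirce a a' y ∧ A.IsPeirce a' a z ∧ x = ⟪a', x⟫ • a + ⟪a, x⟫ • a' + y + z := by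
  have e1 : ⟪a, a⟫ = 0 := by rw [polar_self_eq, h.norm_left, mul_zero]
  have e2 : ⟪a', a'⟫ = 0 := by rw [polar_self_eq, h.norm_right, mul_zero]
  obtain ⟨y, z, hy, hz, hyz⟩ := h.exists_peirce H (x := x - ⟪a', x⟫ • a - ⟪a, x⟫ • a')
    (by simp [QuadraticMap.polar_sub_right, QuadraticMap.polar_smul_right, e1, h.polar_eq])
    (by simp [QuadraticMap.polar_sub_right, QuadraticMap.polar_smul_right, e2, h.symm.polar_eq])
  refine ⟨y, z, hy, hz, ?_⟩
  rw [add_assoc _ y, ← hyz]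
  abel

theorem eq_zero_of_polar (H : A.IsSymmComposition) (h : A.SplitPair a a')
    (h1 : ⟪x, a⟫ = 0) (h2 : ⟪x, a'⟫ = 0) (h3 : ∀ y, A.IsPeirce a a' y → ⟪x, y⟫ = 0)
    (h4 : ∀ y, A.IsPeirce a' a y → ⟪x, y⟫ = 0) : x = 0 := by
  refine H.nondegenerate x fun s => ?_
  obtain ⟨y, z, hy, hz, hs⟩ := h.exists_decomposition H s
  rw [hs]
  simp [QuadraticMap.polar_add_right, QuadraticMap.polar_smul_right, h1, h2, h3 y hy, h4 z hz]

theorem exists_polar_ne_zero (H : A.IsSymmComposition) (h : A.SplitPair a a')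
    (hx : A.IsPeirce a a' x) (hx0 : x ≠ 0) : ∃ y, A.IsPeirce a' a y ∧ ⟪x, y⟫ ≠ 0 := by
  by_contra! hc
  refine hx0 (h.eq_zero_of_polar H ?_ ?_ (fun y hy => h.polar_peirce H hx hy) hc)
  · rw [QuadraticMap.polar_comm, hx.polar_left]
  · rw [QuadraticMap.polar_comm, hx.polar_right]

theorem mul_eq_zero_of_polar (H : A.IsSymmComposition) (h : A.SplitPair a a')
    (hw : A.IsPeirce a' a w) (hy : A.IsPeirce a a' y) (hwy : ⟪w, y ⋆ a⟫ = 0) : w ⋆ y = 0 := by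
  refine h.eq_zero_of_polar H ?_ ?_ (fun u hu => ?_) fun u hu => ?_
  · rw [H.polar_mul, hwy]
  · rw [H.polar_mul, hy.mul_right]; simp
  · rw [H.polar_mul, h.symm.polar_peirce H hw (h.isPeirce_mul H hy hu)]
  · rw [H.polar_rotate, H.polar_rotate, h.polar_peirce H (h.symm.isPeirce_mul H hu hw) hy]

/-- The norm pairs the two Peirce spaces nondegenerately. -/
theorem finrank_peirce_le [FiniteDimensional k S] (H : A.IsSymmComposition)
    (h : A.SplitPair a a') :
    Module.finrank k (A.peirce a' a) ≤ Module.finrank k (A.peirce a a') := by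
  let f : A.peirce a' a →ₗ[k] Module.Dual k (A.peirce a a') :=
    (A.norm.polarBilin.domRestrict₁₂ _ _)
  rw [← Subspace.dual_finrank_eq (V := A.peirce a a')]
  apply LinearMap.finrank_le_finrank_of_injective (f := f)
  rw [← LinearMap.ker_eq_bot, LinearMap.ker_eq_bot']
  rintro ⟨x, hx⟩ hfx
  by_contra h0
  obtain ⟨y, hy, hxy⟩ := h.symm.exists_polar_ne_zero H hx (fun h => h0 (by simp [h]))
  exact hxy (LinearMap.congr_fun hfx ⟨y, hy⟩)

theorem three_le_finrank_peirce (H : A.IsSymmComposition) (h : A.SplitPair a a')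
    (hdim : Module.finrank k S = 8) : 3 ≤ Module.finrank k (A.peirce a a') := by
  have : FiniteDimensional k S := Module.finite_of_finrank_pos (by omega)
  have h1 := h.finrank_peirce_le H
  have htop : Submodule.span k {a, a'} ⊔ A.peirce a a' ⊔ A.peirce a' a = ⊤ := by
    rw [eq_top_iff]
    intro x _
    obtain ⟨y, z, hy, hz, hx⟩ := h.exists_decomposition H x
    rw [hx]
    refine Submodule.add_mem_sup (Submodule.add_mem_sup ?_ hy) hz
    exact Submodule.mem_span_pair.2 ⟨_, _, rfl⟩
  have h2 := Submodule.finrank_add_le_finrank_add_finrank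
    (Submodule.span k {a, a'} ⊔ A.peirce a a') (A.peirce a' a)
  have h3 := Submodule.finrank_add_le_finrank_add_finrank
    (Submodule.span k {a, a'}) (A.peirce a a')
  have h4 : Module.finrank k (Submodule.span k {a, a'}) ≤ 2 := by
    classical
    have := finrank_span_finset_le_card (R := k) ({a, a'} : Finset S)
    simp only [Finset.coe_insert, Finset.coe_singleton] at this
    exact this.trans Finset.card_le_two
  rw [htop, finrank_top] at h2
  omega

theorem exists_mul_ne_zero (H : A.IsSymmComposition) (h : A.SplitPair a a')
    (hdim : Module.finrank k S = 8) :
    ∃ x y, A.IsPeirce a a' x ∧ A.IsPeirce a a' y ∧ x ⋆ y ≠ 0 := by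
  have h3 := h.three_le_finrank_peirce H hdim
  have : FiniteDimensional k S := Module.finite_of_finrank_pos (by omega)
  have : Nontrivial (A.peirce a a') := Module.nontrivial_of_finrank_pos (R := k) (by omega)
  obtain ⟨⟨x, hx⟩, hx0⟩ := exists_ne (0 : A.peirce a a')
  obtain ⟨w, hw, hxw⟩ := h.exists_polar_ne_zero H hx (fun h => hx0 (by simp [h]))
  let f : A.peirce a a' →ₗ[k] k :=
    (A.norm.polarBilin w ∘ₗ A.mul.flip a).domRestrict _
  have hf := LinearMap.ker_ne_bot_of_finrank_lt (f := f) (by simp; omega)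
  obtain ⟨⟨y, hy⟩, hfy, hy0⟩ := Submodule.exists_mem_ne_zero_of_ne_bot hf
  -- `w * y = 0`, hence `(x * y) * w = n(x, w) y ≠ 0`
  refine ⟨x, y, hx, hy, fun h0 => hy0 ?_⟩
  have h1 := H.mul_mul_add x y w
  have h2 := h.mul_eq_zero_of_polar H hw hy hfy
  rw [h0, h2] at h1
  simp only [map_zero, LinearMap.zero_apply, add_zero] at h1
  simpa using (smul_eq_zero.1 h1.symm).resolve_left hxw

end SplitPair

/-! ### Completing a split pair outside characteristic three -/

namespace SplitPair
variable {a a' x y z : S}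

theorem polar_mul_mul_left (H : A.IsSymmComposition) (h : A.SplitPair a a')
    (hx : A.IsPeirce a a' x) (hz : A.IsPeirce a a' z) (p : S) :
    ⟪z ⋆ p, x ⋆ a⟫ = -⟪x ⋆ p, z ⋆ a⟫ := by
  have h1 := congrArg (fun s => ⟪s, a⟫) (H.mul_mul_add z p x)
  simp only [h.polar_peirce H hz hx, zero_smul, QuadraticMap.polar_add_left,
    QuadraticMap.polar_zero_left] at h1
  rw [H.polar_mul, H.polar_mul (x ⋆ p)] at h1
  linear_combination h1

theorem polar_mul_right_mul (H : A.IsSymmComposition) (h : A.SplitPair a a')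
    (hy : A.IsPeirce a a' y) (hz : A.IsPeirce a a' z) (p : S) :
    ⟪p ⋆ z, a' ⋆ y⟫ = -⟪p ⋆ y, a' ⋆ z⟫ := by
  have h1 := congrArg (fun s => ⟪s, a'⟫) (H.mul_add_mul y p z)
  simp only [h.polar_peirce H hy hz, zero_smul, QuadraticMap.polar_add_left,
    QuadraticMap.polar_zero_left] at h1
  rw [H.polar_rotate, H.polar_mul, H.polar_rotate z, H.polar_mul (p ⋆ y)] at h1
  linear_combination h1

/-- The derivation identity on the Peirce space, paired with `a`: the operator `x ↦ x * a` has trace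
zero. -/
theorem polar_mul_trace (H : A.IsSymmComposition) (hd : A.AdIsDerivation) (h : A.SplitPair a a')
    (hx : A.IsPeirce a a' x) (hy : A.IsPeirce a a' y) (hz : A.IsPeirce a a' z) :
    ⟪y ⋆ z, x ⋆ a⟫ + ⟪x ⋆ y, z ⋆ a⟫ + ⟪z ⋆ x, y ⋆ a⟫ = 0 := by
  have h1 := congrArg (fun s => ⟪s, a⟫) (hd x y z)
  have h0 : ∀ u p, A.IsPeirce a a' u → ⟪u ⋆ p, a⟫ = 0 := fun u p hu => by
    rw [H.polar_rotate, H.polar_mul, hu.left_mul]; simp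
  simp only [ad_apply, map_sub, LinearMap.sub_apply, QuadraticMap.polar_add_left,
    QuadraticMap.polar_sub_left, h0 x _ hx, h0 y _ hy] at h1
  rw [H.polar_mul, H.polar_mul (x ⋆ y), H.polar_mul (y ⋆ x),
    h.polar_mul_mul_left H hz hy] at h1
  linear_combination -h1

/-- The derivation identity on the Peirce space, paired with `a'`: the operator `x ↦ a' * x` has
trace zero. -/
theorem polar_mul_trace' (H : A.IsSymmComposition) (hd : A.AdIsDerivation) (h : A.SplitPair a a')
    (hx : A.IsPeirce a a' x) (hy : A.IsPeirce a a' y) (hz : A.IsPeirce a a' z) :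
    ⟪y ⋆ z, a' ⋆ x⟫ + ⟪x ⋆ y, a' ⋆ z⟫ + ⟪z ⋆ x, a' ⋆ y⟫ = 0 := by
  have h1 := congrArg (fun s => ⟪s, a'⟫) (hd x y z)
  have h0 : ∀ u p, A.IsPeirce a a' u → ⟪p ⋆ u, a'⟫ = 0 := fun u p hu => by
    rw [H.polar_mul, hu.mul_right]; simp
  have h2 : ∀ u p, ⟪u ⋆ p, a'⟫ = ⟪p, a' ⋆ u⟫ := fun u p => by
    rw [H.polar_rotate, H.polar_mul]
  simp only [ad_apply, map_sub, LinearMap.sub_apply, QuadraticMap.polar_add_left,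
    QuadraticMap.polar_sub_left, h0 x _ hx, h0 z _ hz] at h1
  rw [h2, h2 y, h2 y] at h1
  have h3 := h.polar_mul_right_mul H hy hz x
  linear_combination h1 + h3

/-- Outside characteristic three, the cubic form does not vanish on a Peirce space. With
`T x = x * a`, the form `n(x * T²y, Tz)` is alternating and `T`-invariant, and `g(b)` is its value
on `b, Tb, T²b`. -/
theorem exists_cubicForm_ne_zero (H : A.IsSymmComposition) (hd : A.AdIsDerivation)
    (h3 : (3 : k) ≠ 0) (h : A.SplitPair a a') (hdim : Module.finrank k S = 8) :
    ∃ b, A.IsPeirce a a' b ∧ A.cubicForm b ≠ 0 := by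
  let T : A.peirce a a' →ₗ[k] A.peirce a a' :=
    (A.mul.flip a).restrict fun x hx => h.isPeirce_mul_left H hx
  have hTa : ∀ x, (T x : S) = (x : S) ⋆ a := fun x => rfl
  have hTT : ∀ x, (T (T x) : S) = a' ⋆ (x : S) := fun x => (h.right_mul H x.2).symm
  have hT : ∀ x, T (T (T x)) = x := fun x => Subtype.ext (h.mul_left_cube H x.2)
  obtain ⟨φ, hφ⟩ : ∃ φ : A.peirce a a' → A.peirce a a' → A.peirce a a' → k,
    ∀ x y z, φ x y z = ⟪(x : S) ⋆ (y : S), z⟫ := ⟨_, fun _ _ _ => rfl⟩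
  have φcyc : ∀ x y z, φ x y z = φ y z x := fun x y z => by rw [hφ, hφ, H.polar_rotate]
  have φ1 : ∀ x y z, φ z y (T x) = -φ x y (T z) := fun x y z => by
    rw [hφ, hφ, hTa, hTa, h.polar_mul_mul_left H x.2 z.2]
  have φ2 : ∀ x y z, φ x z (T (T y)) = -φ x y (T (T z)) := fun x y z => by
    rw [hφ, hφ, hTT, hTT, h.polar_mul_right_mul H y.2 z.2]
  have φ3 : ∀ x y z, φ y z (T x) + φ x y (T z) + φ z x (T y) = 0 := fun x y z => by
    simp only [hφ, hTa]
    exact h.polar_mul_trace H hd x.2 y.2 z.2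
  have φ4 : ∀ x y z, φ y z (T (T x)) + φ x y (T (T z)) + φ z x (T (T y)) = 0 := fun x y z => by
    simp only [hφ, hTT]
    exact h.polar_mul_trace' H hd x.2 y.2 z.2
  obtain ⟨vol, hvol⟩ : ∃ vol : A.peirce a a' → A.peirce a a' → A.peirce a a' → k,
    ∀ x y z, vol x y z = φ x (T (T y)) (T z) := ⟨_, fun _ _ _ => rfl⟩
  have s13 : ∀ x y z, vol z y x = -vol x y z := fun x y z => by rw [hvol, hvol, φ1]
  have s23 : ∀ x y z, vol x z y = -vol x y z := fun x y z => by
    have := φ2 x (T (T y)) (T (T z))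
    rwa [hT, hT, ← hvol, ← hvol] at this
  have s12 : ∀ x y z, vol y x z = -vol x y z := fun x y z => by
    rw [s13, s23, s13, neg_neg]
  have cyc : ∀ x y z, vol y z x = vol x y z := fun x y z => by rw [s23, s12, neg_neg]
  have inv2 : ∀ x y z, vol (T (T x)) (T (T y)) (T (T z)) = vol x y z := fun x y z => by
    rw [← cyc, hvol, hT, hT, hvol x, φcyc x]
  obtain ⟨b, hb⟩ := exists_volume_orbit_ne_zero h3 T vol hT
    (fun x x' y z => by simp [hvol, hφ, QuadraticMap.polar_add_left])
    (fun c x y z => by simp [hvol, hφ, QuadraticMap.polar_smul_left]) s12 s23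
    (fun x y => by
      rw [s23, hvol, hφ, hTa x, ← H.polar_mul, H.mul_mul_self, h.norm_peirce H x.2]; simp)
    (fun x y z => by rw [← inv2, hT, hT, hT])
    (fun x y z => by
      rw [cyc z (T x) y, ← cyc x y (T z), hvol, hvol, hvol, hT, hT, hT]
      linear_combination φ3 x y z)
    (fun x y z => by
      have key : ∀ x y z, vol (T (T x)) y z = φ x y (T (T z)) := fun x y z => by
        rw [← inv2, ← inv2, hT, hT, hT, hT, hvol, hT]
      rw [← cyc x (T (T y)) z, cyc (T (T z)) x y, key, key, key]
      linear_combination φ4 x y z)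
    (by
      obtain ⟨x, y, hx, hy, hxy⟩ := h.exists_mul_ne_zero H hdim
      obtain ⟨z, hz, hxyz⟩ := h.symm.exists_polar_ne_zero H (h.isPeirce_mul H hx hy) hxy
      refine ⟨⟨x, hx⟩, T ⟨y, hy⟩, T (T ⟨z, hz⟩), ?_⟩
      rwa [hvol, hT, hT, hφ])
  refine ⟨b, b.2, ?_⟩
  rwa [hvol, hT, hφ, H.polar_mul] at hb

end SplitPair

/-! ### Inner derivations and the cubic form in characteristic three -/

theorem cubicForm_smul (c : k) (x : S) : A.cubicForm (c • x) = c ^ 3 * A.cubicForm x := by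
  simp only [cubicForm, map_smul, LinearMap.smul_apply, QuadraticMap.polar_smul_left,
    QuadraticMap.polar_smul_right, smul_eq_mul]
  ring

theorem cubicForm_neg (x : S) : A.cubicForm (-x) = -A.cubicForm x := by
  rw [← neg_one_smul k x, cubicForm_smul]
  ring

namespace IsSymmComposition

theorem cubicForm_mul_self (H : A.IsSymmComposition) {x : S} (hx : A.norm x = 0) :
    A.cubicForm (x ⋆ x) = A.cubicForm x ^ 2 := by
  rw [cubicForm, H.sq_mul_sq, hx, zero_smul, sub_zero, QuadraticMap.polar_smul_right,
    QuadraticMap.polar_comm, smul_eq_mul, cubicForm]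
  ring

theorem cubicForm_add_of_three (H : A.IsSymmComposition) (h3 : (3 : k) = 0) (x y : S) :
    A.cubicForm (x + y) = A.cubicForm x + A.cubicForm y := by
  rw [H.cubicForm_add, h3]
  ring

section Idempotent
variable {e : S}

theorem cubicForm_idempotent (he : e ⋆ e = e) (hn : A.norm e = 1) :
    A.cubicForm e = 2 := by
  rw [cubicForm, he, polar_self_eq, hn, mul_one]

/-- In particular, `g(e * x) = g(x * e)` in characteristic three, as `e * (x * e) = x`. -/
theorem cubicForm_idempotent_mul (H : A.IsSymmComposition) (he : e ⋆ e = e) (hn : A.norm e = 1)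
    (x : S) :
    A.cubicForm (e ⋆ x) = 3 * ⟪e, x⟫ * ⟪e, x ⋆ x⟫ - ⟪e, x⟫ ^ 3 - A.cubicForm x := by
  have h1 := congrArg (fun s => s ⋆ e) (H.mul_mul_add x x e)
  have h2 := H.mul_mul_add (e ⋆ x) x e
  have h3 := H.mul_idempotent_mul he (x ⋆ x)
  have p1 : ⟪e ⋆ x, e⟫ = ⟪e, x⟫ := by rw [H.polar_rotate, H.polar_mul, he, QuadraticMap.polar_comm]
  have p2 : ⟪e ⋆ x, x⟫ = ⟪e, x ⋆ x⟫ := H.polar_mul e x x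
  have p3 : ⟪e ⋆ x, x ⋆ e⟫ = ⟪e, x⟫ ^ 2 - ⟪e, x ⋆ x⟫ := by
    rw [QuadraticMap.polar_comm, ← H.polar_mul, H.mul_idempotent_mul he,
      QuadraticMap.polar_sub_left, QuadraticMap.polar_smul_left, p2, smul_eq_mul, sq]
  have p4 : ⟪e ⋆ x, e ⋆ (x ⋆ x)⟫ = A.cubicForm x := by
    rw [← H.polar_mul, H.mul_mul_self, hn, one_smul, cubicForm]
  simp only [map_add, map_smul, LinearMap.add_apply, LinearMap.smul_apply, h3,
    QuadraticMap.polar_comm _ x e] at h1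
  rw [p1] at h2
  have h4 : (e ⋆ x) ⋆ (e ⋆ x) =
      ⟪e, x⟫ • x - ⟪e, x⟫ • (x ⋆ e) + ⟪e, x ⋆ x⟫ • e - e ⋆ (x ⋆ x) := by
    linear_combination (norm := module) h2 - h1
  rw [cubicForm, h4]
  simp only [QuadraticMap.polar_add_right, QuadraticMap.polar_sub_right,
    QuadraticMap.polar_smul_right, p1, p2, p3, p4, smul_eq_mul]
  ring

theorem cubicForm_ad (H : A.IsSymmComposition) (h3 : (3 : k) = 0) (he : e ⋆ e = e)
    (hn : A.norm e = 1) (x : S) : A.cubicForm (A.ad e x) = 0 := by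
  have h1 := H.cubicForm_idempotent_mul he hn x
  have h2 := H.cubicForm_idempotent_mul he hn (x ⋆ e)
  have p1 : ⟪e, x ⋆ e⟫ = ⟪e, x⟫ := by
    rw [QuadraticMap.polar_comm, H.polar_mul, he, QuadraticMap.polar_comm]
  rw [H.self_mul_mul, hn, one_smul, p1, h3] at h2
  rw [h3] at h1
  rw [ad_apply, sub_eq_add_neg, H.cubicForm_add_of_three h3, cubicForm_neg]
  linear_combination h1 - h2

theorem cubicForm_eq_of_ad_eq_zero (H : A.IsSymmComposition) (h3 : (3 : k) = 0) (he : e ⋆ e = e)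
    (hn : A.norm e = 1) {h : S} (hh : A.ad e h = 0) : A.cubicForm h = ⟪e, h⟫ ^ 3 := by
  -- in characteristic three `n(e, e) = 2 = -1`, so `t` below is orthogonal to `e`
  obtain ⟨t, ht⟩ : ∃ t, t = h + ⟪e, h⟫ • e := ⟨_, rfl⟩
  have hee : ⟪e, e⟫ = -1 := by rw [polar_self_eq, hn]; linear_combination h3
  have het : ⟪e, t⟫ = 0 := by
    rw [ht, QuadraticMap.polar_add_right, QuadraticMap.polar_smul_right, hee]; simp
  have ht0 : A.ad e t = 0 := by rw [ht, map_add, hh, map_smul, ad_self]; simp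
  have hc : e ⋆ t = t ⋆ e := sub_eq_zero.1 ht0
  have h1 : e ⋆ t = -t := by
    have := H.idempotent_mul_mul he t
    rw [hc, H.self_mul_mul, hn, het] at this
    rw [hc]
    linear_combination (norm := module) this
  have h2 : t ⋆ (e ⋆ t) = A.norm t • e := H.self_mul_mul _ _
  have h4 : A.cubicForm t = 0 := by
    rw [h1, map_neg, neg_eq_iff_eq_neg] at h2
    rw [cubicForm, h2, QuadraticMap.polar_neg_right, QuadraticMap.polar_smul_right,
      QuadraticMap.polar_comm, het]
    simp
  rw [ht, H.cubicForm_add_of_three h3, cubicForm_smul, cubicForm_idempotent he hn] at h4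
  linear_combination h4 - ⟪e, h⟫ ^ 3 * h3

theorem cubicForm_eq_of_mem (H : A.IsSymmComposition) (h3 : (3 : k) = 0) (he : e ⋆ e = e)
    (hn : A.norm e = 1) {x : S} (hx : x ∈ (A.ad e).ker ⊔ (A.ad e).range) :
    A.cubicForm x = ⟪e, x⟫ ^ 3 := by
  obtain ⟨h, hh, y, ⟨z, rfl⟩, rfl⟩ := Submodule.mem_sup.1 hx
  rw [H.cubicForm_add_of_three h3, H.cubicForm_ad h3 he hn,
    H.cubicForm_eq_of_ad_eq_zero h3 he hn hh, QuadraticMap.polar_add_right,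
    QuadraticMap.polar_comm _ e (A.ad e z), H.ad_polar, ad_self]
  simp

end Idempotent

end IsSymmComposition

/-! ### Isotropic elements and split pairs in characteristic three -/

variable (A) in
/-- The orthogonal subspace for the polar form of the norm. -/
def perp (W : Submodule k S) : Submodule k S :=
  LinearMap.BilinForm.orthogonal A.norm.polarBilin W

theorem mem_perp {W : Submodule k S} {x : S} : x ∈ A.perp W ↔ ∀ y ∈ W, ⟪y, x⟫ = 0 := Iff.rfl

namespace IsSymmComposition

theorem finrank_perp [FiniteDimensional k S] (H : A.IsSymmComposition) (W : Submodule k S) :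
    Module.finrank k W + Module.finrank k (A.perp W) = Module.finrank k S := by
  have hker : LinearMap.ker A.norm.polarBilin = ⊥ :=
    LinearMap.ker_eq_bot'.2 fun x hx => H.nondegenerate x fun y => LinearMap.congr_fun hx y
  have := LinearMap.BilinForm.finrank_add_finrank_orthogonal' (B := A.norm.polarBilin) W
  rwa [hker, inf_bot_eq, finrank_bot, add_zero] at this

/-- Totally isotropic subspaces have dimension at most four. -/
theorem finrank_le_of_norm_eq_zero (H : A.IsSymmComposition) (hdim : Module.finrank k S = 8)
    {W : Submodule k S} (hW : ∀ x ∈ W, A.norm x = 0) : Module.finrank k W ≤ 4 := by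
  have : FiniteDimensional k S := Module.finite_of_finrank_pos (by omega)
  have h1 := H.finrank_perp W
  have h2 : W ≤ A.perp W := fun x hx => mem_perp.2 fun y hy => by
    rw [QuadraticMap.polar, hW _ hx, hW _ hy, hW _ (W.add_mem hy hx)]
    simp
  have h3 := Submodule.finrank_mono h2
  omega

/-- The totally isotropic subspace `S * z` attached to an isotropic vector `z` has dimension at
least four: it contains the kernel of left multiplication by `z`, whose image is totally isotropic.
-/
theorem four_le_finrank_range (H : A.IsSymmComposition) (hdim : Module.finrank k S = 8) {z : S}
    (hz0 : z ≠ 0) (hz : A.norm z = 0) : 4 ≤ Module.finrank k (A.mul.flip z).range := by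
  have : FiniteDimensional k S := Module.finite_of_finrank_pos (by omega)
  obtain ⟨t, ht⟩ : ∃ t, ⟪t, z⟫ ≠ 0 := by
    by_contra! h
    exact hz0 (H.nondegenerate z fun y => by rw [QuadraticMap.polar_comm, h])
  have h1 : (A.mul z).ker ≤ (A.mul.flip z).range := fun y hy => by
    have hy' : z ⋆ y = 0 := hy
    have := H.mul_mul_add t y z
    rw [hy', map_zero, LinearMap.zero_apply, add_zero] at this
    refine ⟨⟪t, z⟫⁻¹ • (t ⋆ y), ?_⟩
    rw [map_smul, LinearMap.flip_apply, this, inv_smul_smul₀ ht]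
  have h2 := (A.mul z).finrank_range_add_finrank_ker
  have h3 := Submodule.finrank_mono h1
  have h4 : Module.finrank k (A.mul z).range ≤ 4 := H.finrank_le_of_norm_eq_zero hdim (by
    rintro _ ⟨y, rfl⟩
    rw [H.norm_mul, hz, zero_mul])
  omega

/-- If the norm is isotropic and the orthogonal space `R` of `X` is a proper subspace of `X`, then
`X / R` is isotropic. Otherwise a totally isotropic `F` of dimension four meets `X` inside `R`, so
that `F + X` is orthogonal to `F ∩ X`, which is impossible for reasons of dimension. -/
theorem exists_isotropic_of_perp_le (H : A.IsSymmComposition) (hdim : Module.finrank k S = 8)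
    (hi : A.HasIsotropicNorm) {X : Submodule k S} (hX : A.perp X < X) :
    ∃ z ∈ X, A.norm z = 0 ∧ z ∉ A.perp X := by
  have : FiniteDimensional k S := Module.finite_of_finrank_pos (by omega)
  obtain ⟨z, hz0, hz⟩ := hi
  by_contra! hc
  obtain ⟨F, hF⟩ : ∃ F, F = (A.mul.flip z).range := ⟨_, rfl⟩
  have hF4 : 4 ≤ Module.finrank k F := hF ▸ H.four_le_finrank_range hdim hz0 hz
  have hFn : ∀ x ∈ F, A.norm x = 0 := by
    rw [hF]
    rintro _ ⟨y, rfl⟩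
    rw [LinearMap.flip_apply, H.norm_mul, hz, mul_zero]
  have hle : F ⊔ X ≤ A.perp (F ⊓ X) := by
    rw [sup_le_iff]
    constructor
    · intro x hx
      refine mem_perp.2 fun y hy => ?_
      rw [QuadraticMap.polar, hFn _ hx, hFn _ hy.1, hFn _ (F.add_mem hy.1 hx)]
      simp
    · intro x hx
      refine mem_perp.2 fun y hy => ?_
      rw [QuadraticMap.polar_comm]
      exact mem_perp.1 (hc y hy.2 (hFn y hy.1)) x hx
  have h1 := Submodule.finrank_sup_add_finrank_inf_eq F X
  have h2 := Submodule.finrank_mono hle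
  have h3 := H.finrank_perp (F ⊓ X)
  have h4 := H.finrank_perp X
  have h5 := Submodule.finrank_lt_finrank_of_lt hX
  omega

/-- In characteristic three, an isotropic norm and an idempotent give an isotropic element `a` with
`g(a) = -1`. -/
theorem exists_cubicForm_eq_neg_one_of_three (H : A.IsSymmComposition)
    (hdim : Module.finrank k S = 8) (h3 : (3 : k) = 0) (hi : A.HasIsotropicNorm) {e : S}
    (he : e ⋆ e = e) (hn : A.norm e = 1) : ∃ a, A.norm a = 0 ∧ A.cubicForm a = -1 := by
  obtain ⟨X, hX⟩ : ∃ X, X = (A.ad e).ker ⊔ (A.ad e).range := ⟨_, rfl⟩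
  have hee : ⟪e, e⟫ = -1 := by rw [polar_self_eq, hn]; linear_combination h3
  have heX : e ∈ X := hX ▸ Submodule.mem_sup_left (ad_self e)
  have hperp : A.perp X < X := by
    refine lt_of_le_of_ne (fun x hx => ?_) fun h => ?_
    · rw [hX]
      refine Submodule.mem_sup_left (H.nondegenerate _ fun y => ?_)
      rw [H.ad_polar, QuadraticMap.polar_comm,
        mem_perp.1 hx _ (hX ▸ Submodule.mem_sup_right ⟨y, rfl⟩), neg_zero]
    · have := mem_perp.1 (by rw [h]; exact heX : e ∈ A.perp X) e heX
      rw [hee] at this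
      exact one_ne_zero (neg_eq_zero.1 this)
  obtain ⟨z, hzX, hz, hzp⟩ := H.exists_isotropic_of_perp_le hdim hi hperp
  -- move the isotropic vector `z` within `X` until it is not orthogonal to `e`
  obtain ⟨m, hmX, hm, hem⟩ : ∃ m ∈ X, A.norm m = 0 ∧ ⟪e, m⟫ ≠ 0 := by
    by_cases hez : ⟪e, z⟫ = 0
    · obtain ⟨m, hmX, hmz, hem⟩ : ∃ m ∈ X, ⟪m, z⟫ ≠ 0 ∧ ⟪e, m⟫ ≠ 0 := by
        obtain ⟨m, hmX, hmz⟩ : ∃ m ∈ X, ⟪m, z⟫ ≠ 0 := by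
          by_contra! h
          exact hzp (mem_perp.2 h)
        by_cases hem : ⟪e, m⟫ = 0
        · refine ⟨m + e, X.add_mem hmX heX, ?_, ?_⟩
          · rwa [QuadraticMap.polar_add_left, hez, add_zero]
          · rw [QuadraticMap.polar_add_right, hem, hee]; simp
        · exact ⟨m, hmX, hmz, hem⟩
      refine ⟨m - (A.norm m / ⟪m, z⟫) • z, X.sub_mem hmX (X.smul_mem _ hzX), ?_, ?_⟩
      · rw [sub_eq_add_neg, norm_add, QuadraticMap.map_neg, QuadraticMap.map_smul, hz,
          QuadraticMap.polar_neg_right, QuadraticMap.polar_smul_right, smul_eq_mul, smul_eq_mul,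
          div_mul_cancel₀ _ hmz]
        ring
      · rwa [QuadraticMap.polar_sub_right, QuadraticMap.polar_smul_right, hez, smul_zero, sub_zero]
    · exact ⟨z, hzX, hz, hez⟩
  refine ⟨-(⟪e, m⟫⁻¹ • m), by simp [QuadraticMap.map_smul, hm], ?_⟩
  rw [cubicForm_neg, cubicForm_smul, H.cubicForm_eq_of_mem h3 he hn (hX ▸ hmX), ← mul_pow,
    inv_mul_cancel₀ hem, one_pow]

end IsSymmComposition

namespace SplitPair
variable {a a' x y : S}

/-- In characteristic three, if `g` vanishes on one Peirce space, then it vanishes on the opposite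
one, since `g(b * b) = g(b)²` there, and `g` is the cube of a linear form. -/
theorem cubicForm_eq (H : A.IsSymmComposition) (h3 : (3 : k) = 0) (h : A.SplitPair a a')
    (hU : ∀ b, A.IsPeirce a a' b → A.cubicForm b = 0) (v : S) :
    A.cubicForm v = -(⟪a + a', v⟫) ^ 3 := by
  have hW : ∀ b, A.IsPeirce a' a b → A.cubicForm b = 0 := fun b hb => by
    have := hU _ (h.symm.isPeirce_mul H hb hb)
    rw [H.cubicForm_mul_self (h.symm.norm_peirce H hb)] at this
    exact pow_eq_zero_iff two_ne_zero |>.1 this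
  have hga : A.cubicForm a = -1 := by
    rw [cubicForm, h.left_mul_left, QuadraticMap.polar_neg_right, h.polar_eq]
  have hga' : A.cubicForm a' = -1 := by
    rw [cubicForm, h.right_mul_right, QuadraticMap.polar_neg_right, h.symm.polar_eq]
  obtain ⟨y, z, hy, hz, hv⟩ := h.exists_decomposition H v
  have : A.cubicForm v = -⟪a', v⟫ ^ 3 - ⟪a, v⟫ ^ 3 := by
    conv_lhs => rw [hv]
    simp only [H.cubicForm_add_of_three h3, cubicForm_smul, hga, hga', hU y hy, hW z hz]
    ring
  rw [this, QuadraticMap.polar_add_left]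
  linear_combination (⟪a, v⟫ ^ 2 * ⟪a', v⟫ + ⟪a, v⟫ * ⟪a', v⟫ ^ 2) * h3

/-- If `g` vanishes on all Peirce spaces, then comparing the formulas of `cubicForm_eq` for the
pairs with first members `a` and `a + x` shows that the two pairs have the same sum. -/
theorem mul_left_eq_self (H : A.IsSymmComposition) (h3 : (3 : k) = 0)
    (hno : ∀ a a' : S, A.SplitPair a a' → ∀ b, A.IsPeirce a a' b → A.cubicForm b = 0)
    (h : A.SplitPair a a') (hx : A.IsPeirce a a' x) : x ⋆ a = x := by
  have hga : A.cubicForm (a + x) = -1 := by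
    rw [H.cubicForm_add_of_three h3, hno a a' h x hx, cubicForm, h.left_mul_left,
      QuadraticMap.polar_neg_right, h.polar_eq, add_zero]
  have h2 := H.splitPair (a := a + x)
    (by rw [norm_add, h.norm_left, h.norm_peirce H hx, hx.polar_left]; ring) hga
  have key : a + a' - (a + x + -((a + x) ⋆ (a + x))) = 0 := by
    refine H.nondegenerate _ fun v => ?_
    have e1 := h.cubicForm_eq H h3 (hno _ _ h) v
    rw [h2.cubicForm_eq H h3 (hno _ _ h2) v] at e1
    rw [QuadraticMap.polar_sub_left]
    generalize ⟪a + a', v⟫ = p at *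
    generalize ⟪a + x + -((a + x) ⋆ (a + x)), v⟫ = q at *
    have e2 : (p - q) ^ 3 = 0 := by linear_combination e1 + (- p ^ 2 * q + p * q ^ 2) * h3
    exact pow_eq_zero_iff three_ne_zero |>.1 e2
  have hsq : x ⋆ x = x - x ⋆ a := by
    simp only [map_add, LinearMap.add_apply, h.left_mul_left, hx.left_mul] at key
    linear_combination (norm := module) key
  have h4 : A.IsPeirce a a' (x ⋆ x) :=
    hsq ▸ (A.peirce a a').sub_mem hx (h.isPeirce_mul_left H hx)
  have h5 := h.isPeirce_mul H hx hx
  have h6 : x ⋆ x = 0 := by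
    by_contra h0
    obtain ⟨y, hy, hxy⟩ := h.exists_polar_ne_zero H h4 h0
    exact hxy (h.symm.polar_peirce H h5 hy)
  rw [h6] at hsq
  exact (sub_eq_zero.1 hsq.symm).symm

/-- In characteristic three, some split pair has a Peirce space on which `g` does not vanish;
otherwise `a + a'` would commute with all elements. The given pair may have to be replaced. -/
theorem exists_cubicForm_ne_zero_of_three (H : A.IsSymmComposition) (h3 : (3 : k) = 0)
    (hc : ∀ c, (∀ x, c ⋆ x = x ⋆ c) → c = 0) (h : A.SplitPair a a') :
    ∃ a a' b, A.SplitPair a a' ∧ A.IsPeirce a a' b ∧ A.cubicForm b ≠ 0 := by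
  by_contra! hno'
  have hno : ∀ a a' : S, A.SplitPair a a' → ∀ b, A.IsPeirce a a' b → A.cubicForm b = 0 :=
    fun a a' h b hb => hno' a a' b h hb
  have hcU : ∀ a a', A.SplitPair a a' → ∀ x, A.IsPeirce a a' x →
      (a + a') ⋆ x = x ⋆ (a + a') := fun a a' h x hx => by
    have h1 := h.mul_left_eq_self H h3 hno hx
    rw [map_add, map_add, LinearMap.add_apply, hx.left_mul, hx.mul_right, h.right_mul H hx, h1, h1]
    abel
  have h0 : a + a' = 0 := by
    refine hc _ fun x => ?_
    obtain ⟨y, z, hy, hz, hx⟩ := h.exists_decomposition H x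
    have e1 := hcU _ _ h y hy
    have e2 := hcU _ _ h.symm z hz
    rw [add_comm a' a] at e2
    rw [hx, map_add, map_add, e1, e2]
    simp [h.left_mul_right, h.right_mul_left, add_comm]
  have h1 : ⟪a, a + a'⟫ = 1 := by
    rw [QuadraticMap.polar_add_right, h.polar_eq, polar_self_eq, h.norm_left]; ring
  rw [h0] at h1
  simp at h1

end SplitPair

theorem exists_isIsomorphic_okuboO (hA : A.IsOkubo) (hi : A.HasIsotropicNorm)
    (hid : A.HasNonzeroIdempotent) : ∃ β : k, β ≠ 0 ∧ A.IsIsomorphic (okuboO (1 : k) β) := by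
  have H := hA.isSymmComposition
  have hdim := hA.finrank_eq
  have hd : A.AdIsDerivation := hA.derivation
  obtain ⟨e, he0, he⟩ := hid
  have hn := H.norm_idempotent he he0
  obtain ⟨a, a', b, h, hb, hg⟩ :
      ∃ a a' b, A.SplitPair a a' ∧ A.IsPeirce a a' b ∧ A.cubicForm b ≠ 0 := by
    by_cases h3 : (3 : k) = 0
    · obtain ⟨a, ha, hga⟩ := H.exists_cubicForm_eq_neg_one_of_three hdim h3 hi he hn
      exact (H.splitPair ha hga).exists_cubicForm_ne_zero_of_three H h3 hA.center
    · obtain ⟨a, ha, hga⟩ := H.exists_cubicForm_eq_neg_one hd h3 hi he hn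
      have h := H.splitPair ha hga
      obtain ⟨b, hb, hg⟩ := h.exists_cubicForm_ne_zero H hd h3 hdim
      exact ⟨a, _, b, h, hb, hg⟩
  have hga : A.cubicForm a = -1 := by
    rw [cubicForm, h.left_mul_left, QuadraticMap.polar_neg_right, h.polar_eq]
  exact ⟨-A.cubicForm b, neg_ne_zero.2 hg, (H.generatingPair one_ne_zero (neg_ne_zero.2 hg) h.norm_left
    (h.norm_peirce H hb) hga (neg_neg _).symm hb.left_mul hb.polar_left).isIsomorphic_okuboO
    H hdim⟩

end NormAlgebra

theorem mainTheorem5 {k : Type u} [Field k] {S : Type v} [AddCommGroup S] [Module k S]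
    (A : NormAlgebra k S) :
    (A.IsOkubo ∧ A.HasIsotropicNorm ∧ A.HasNonzeroIdempotent) ↔
      ∃ β : k, β ≠ 0 ∧ A.IsIsomorphic (okuboO (1 : k) β) :=
  ⟨fun ⟨h1, h2, h3⟩ => NormAlgebra.exists_isIsomorphic_okuboO h1 h2 h3, fun ⟨_, hβ, h⟩ =>
    ⟨h.isOkubo hβ, h.hasIsotropicNorm, h.hasNonzeroIdempotent⟩⟩
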